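/- Let $\mathbb{R}^+=(0,\infty)$, let $f\in C^2(\mathbb{R})$, let $\Omega\subseteq\mathbb{R}^+\times\mathbb{R}$ be open and let $u\in C(\Omega)$. A \emph{Lagrangian parameterization} associated with $u$ is a continuous function $\chi:\mathbb{R}^+\times\mathbb{R}\to\mathbb{R}$ such that for every $t>0$ the map $y\mapsto\chi(t,y)$ is nondecreasing and onto $\mathbb{R}$, and for every $y\in\mathbb{R}$ the curve $t\mapsto\chi(t,y)$ satisfies $\partial_t\chi(t,y)=f'(u(t,\chi(t,y)))$ at every $t$ in the open set $T_y=\{t>0:(t,\chi(t,y))\in\Omega\}$. The function $u$ is a \emph{continuous Lagrangian solution} of \[\partial_t u+\partial_x f(u)=g\] in $\Omega$, with parameterization $\chi$ and Lagrangian source the bounded Borel function $g_L:\Omega\to\mathbb{R}$, if for every $y\in\mathbb{R}$ \[\frac{d}{dt}\,u(t,\chi(t,y))=g_L(t,\chi(t,y))\qquad\text{in the sense of distributions on }T_y .\] Suppose that $u$ is such a solution and that $|g_L(t,\chi(t,y))|\le G$ for every $y\in\mathbb{R}$ and almost every $t\in T_y$. Then there is $g_E\in L^\infty(\Omega)$ with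 $|g_E|\le G$ almost everywhere in $\Omega$ such that $u$ is a continuous distributional (Eulerian) solution with source $g_E$, that is, \[\partial_t u+\partial_x f(u)=g_E\qquad\text{in the sense of distributions on }\Omega,\] and, with the same $g_E$, $u$ dissipates no entropy: for all $\eta,q\in C^1(\mathbb{R})$ with $q'=\eta' f'$, \[\partial_t\,\eta(u)+\partial_x\,q(u)=\eta'(u)\,g_E\qquad\text{in the sense of distributions on }\Omega .\] -/

import Mathlib

open MeasureTheory Set
open scoped ContDiff

/-- The open half plane `ℝ⁺ × ℝ` of points `(t, x)` with `t > 0`. -/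
def halfPlane : Set (ℝ × ℝ) := Ioi 0 ×ˢ univ

/-- The set of times `i_γ⁻¹(Ω)` at which the graph of the curve `γ` lies in `Ω`. -/
def curveTimes (Ω : Set (ℝ × ℝ)) (γ : ℝ → ℝ) : Set ℝ := {t | (t, γ t) ∈ Ω}

/-- `φ ∈ C_c^∞(U)`, as a function on the whole space vanishing off a compact subset of `U`. -/
structure IsTestFunction {E : Type*} [NormedAddCommGroup E] [NormedSpace ℝ E]
    (U : Set E) (φ : E → ℝ) : Prop where
  smooth : ContDiff ℝ ∞ φ
  compact : HasCompactSupport φ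
  supp : tsupport φ ⊆ U

/-- `∂ₜ a + ∂ₓ b = h` in the sense of distributions on `Ω`. -/
def DistribBalance (Ω : Set (ℝ × ℝ)) (a b h : ℝ × ℝ → ℝ) : Prop :=
  ∀ φ : ℝ × ℝ → ℝ, IsTestFunction Ω φ →
    -∫ p in Ω, (fderiv ℝ φ p (1, 0) * a p + fderiv ℝ φ p (0, 1) * b p) = ∫ p in Ω, φ p * h p

/-- `v' = h` in the sense of distributions on the set `T` of times. -/
def DistribDeriv (T : Set ℝ) (v h : ℝ → ℝ) : Prop :=
  ∀ φ : ℝ → ℝ, IsTestFunction T φ →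
    -∫ t in T, deriv φ t * v t = ∫ t in T, φ t * h t

/-- `γ` is a characteristic curve of `u` in `Ω`: it solves `γ' = f'(u(t, γ))` as long as its graph
is in `Ω`. The right-hand side is continuous along `γ`, so an absolutely continuous solution is a
classical one. -/
def IsCharacteristic (f : ℝ → ℝ) (Ω : Set (ℝ × ℝ)) (u : ℝ × ℝ → ℝ) (γ : ℝ → ℝ) : Prop :=
  ∀ t ∈ curveTimes Ω γ, HasDerivAt γ (deriv f (u (t, γ t))) t

/-- Lagrangian parameterization `χ(t, y)`, `t > 0`, `y ∈ ℝ`, associated with `u ∈ C(Ω)`. -/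
structure IsLagrangianParam (f : ℝ → ℝ) (Ω : Set (ℝ × ℝ)) (u : ℝ × ℝ → ℝ)
    (χ : ℝ → ℝ → ℝ) : Prop where
  continuousOn : ContinuousOn (fun p : ℝ × ℝ => χ p.1 p.2) halfPlane
  surjective : ∀ t, 0 < t → Function.Surjective (χ t)
  monotone : ∀ t, 0 < t → Monotone (χ t)
  characteristic : ∀ y, IsCharacteristic f Ω u (fun t => χ t y)

/-- `u` is a continuous Lagrangian solution in `Ω` with Lagrangian parameterization `χ` and
Lagrangian source the class of the bounded Borel function `g`. -/
structure IsLagrangianSolution (f : ℝ → ℝ) (Ω : Set (ℝ × ℝ)) (u : ℝ × ℝ → ℝ)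
    (χ : ℝ → ℝ → ℝ) (g : ℝ × ℝ → ℝ) : Prop where
  continuousOn : ContinuousOn u Ω
  param : IsLagrangianParam f Ω u χ
  source_borel : Measurable (Ω.domRestrict g)
  source_bounded : ∃ M : ℝ, ∀ p ∈ Ω, |g p| ≤ M
  deriv_eq : ∀ y, DistribDeriv (curveTimes Ω fun t => χ t y)
    (fun t => u (t, χ t y)) (fun t => g (t, χ t y))

/-- The Lagrangian source `g` is bounded by `G`: functions that agree a.e. along every curve of `χ`
are identified, so the bound is required a.e. along every such curve. -/
def LagrangianSourceBound (Ω : Set (ℝ × ℝ)) (χ : ℝ → ℝ → ℝ) (g : ℝ × ℝ → ℝ) (G : ℝ) : Prop :=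
  ∀ y, ∀ᵐ t ∂(volume.restrict (curveTimes Ω fun t => χ t y)), |g (t, χ t y)| ≤ G

/-- `u` is a continuous distributional (Eulerian) solution of `∂ₜ u + ∂ₓ f(u) = g` in `Ω`, with
source `g ∈ L^∞(Ω)`. -/
structure IsEulerianSolution (f : ℝ → ℝ) (Ω : Set (ℝ × ℝ)) (u : ℝ × ℝ → ℝ)
    (g : ℝ × ℝ → ℝ) : Prop where
  continuousOn : ContinuousOn u Ω
  source_memLp : MemLp g ⊤ (volume.restrict Ω)
  balance : DistribBalance Ω u (fun p => f (u p)) g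

/-- Entropy-entropy flux pair `η, q ∈ C¹(ℝ)`, `q' = η' f'`. -/
structure IsEntropyPair (f η q : ℝ → ℝ) : Prop where
  entropy_smooth : ContDiff ℝ 1 η
  flux_smooth : ContDiff ℝ 1 q
  deriv_flux : ∀ z, deriv q z = deriv η z * deriv f z

/-! The heart is a local estimate: near each point of Ω, if |η'| ≤ c on the nearby values of u, then
|∬ (φ_t η(u) + φ_x q(u))| ≤ cG ∬ |φ|. Cut a neighbourhood into thin cells by characteristics χ(·,
z_j) and write U_j(t) for the value of u on the j-th one. The time derivative of the integral of φ
over a cell's section is ∫ φ_t dx plus the difference of φ f'(u) at the two ends. Multiply it by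
η(M_j(t)), with M_j close to u in the cell: if M_j is G-Lipschitz in time, integration by parts in t
bounds each cell by cG ∬ |φ|. Summation by parts over j recovers the wanted balance, apart from
replacing u by M_j and from node errors φ · (f'(U_{j+1}) Δη − Δq), which are o(|M_{j+1} − M_j|).

The obstacle is that u need not have bounded variation in x, so with M_j = U_j the node errors could
not be summed. The median chain removes it: it runs from U_0 to U_n monotonically, with total
variation at most |U_0 − U_n|; it moves only through values lying between U_j and U_{j+1}, where f'
is nearly f'(U_{j+1}); and it is nonexpansive in its data, hence still G-Lipschitz in time. The
price is that M_j agrees with u only up to the oscillation across the whole strip. So there are two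
subdivisions: `IsEntropyPair.abs_strip_balance_le` refines inside a fixed strip, and
`IsEntropyPair.abs_integral_strip_le` then takes narrow strips, whose side terms telescope.

A partition of unity makes the estimate global (`abs_le_of_locally_abs_le`). For η = id it gives g_E
by Riesz representation (`exists_eq_integral_of_abs_le`). For general η, near p subtract η'(u(p))
times the balance law: what is left is an entropy with small derivative, so the entropy defect is
bounded by every small multiple of the L¹ norm, and vanishes. -/

/-! ### Median chains. -/

/-- The median of three real numbers. -/
def median (a b c : ℝ) : ℝ := max (min a b) (min (max a b) c)

/-- The chain that starts at `U 0` and, at each step, moves towards the target `V` as far as the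
hull of its current position and the next value of `U` allows. -/
def medianChain (V : ℝ) (U : ℕ → ℝ) : ℕ → ℝ
  | 0 => U 0
  | j + 1 => median (medianChain V U j) (U (j + 1)) V

lemma abs_median_sub_median_le {a b c a' b' c' r : ℝ} (ha : |a - a'| ≤ r) (hb : |b - b'| ≤ r)
    (hc : |c - c'| ≤ r) : |median a b c - median a' b' c'| ≤ r := by
  unfold median
  refine (abs_max_sub_max_le_max _ _ _ _).trans (max_le ?_ ?_)
  · exact (abs_min_sub_min_le_max _ _ _ _).trans (max_le ha hb)
  · refine (abs_min_sub_min_le_max _ _ _ _).trans (max_le ?_ hc)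
    exact (abs_max_sub_max_le_max _ _ _ _).trans (max_le ha hb)

/-- The median is nonexpansive for the sup norm, and so are its iterates. This makes the chain
inherit, with the same constant, the Lipschitz bound in time of the values of u along
characteristics. -/
lemma abs_medianChain_sub_le {V V' r : ℝ} {U U' : ℕ → ℝ} (hV : |V - V'| ≤ r) (j : ℕ)
    (hU : ∀ i ≤ j, |U i - U' i| ≤ r) : |medianChain V U j - medianChain V' U' j| ≤ r := by
  induction j with
  | zero => exact hU 0 le_rfl
  | succ j ih =>
    exact abs_median_sub_median_le (ih fun i hi => hU i (by omega)) (hU _ le_rfl) hV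

lemma medianChain_mem_Icc {V m₁ m₂ : ℝ} {U : ℕ → ℝ} (hV : V ∈ Icc m₁ m₂) (j : ℕ)
    (hU : ∀ i ≤ j, U i ∈ Icc m₁ m₂) : medianChain V U j ∈ Icc m₁ m₂ := by
  induction j with
  | zero => exact hU 0 le_rfl
  | succ j ih =>
    have h₁ := ih fun i hi => hU i (by omega)
    have h₂ := hU (j + 1) le_rfl
    simp only [medianChain, median, mem_Icc] at *
    grind

lemma medianChain_mem_uIcc (V : ℝ) (U : ℕ → ℝ) (j : ℕ) :
    medianChain V U j ∈ uIcc (U j) V := by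
  cases j with
  | zero => exact left_mem_uIcc
  | succ j =>
    simp only [medianChain, median, mem_uIcc]
    grind

lemma medianChain_eq_last (U : ℕ → ℝ) (n : ℕ) : medianChain (U n) U n = U n := by
  simpa using medianChain_mem_uIcc (U n) U n

/-- A step goes towards V and never past it, so the length travelled is exactly the distance to V
that is gained. The sum telescopes: the variation of the chain is controlled independently of the
number of steps and of the variation of U. -/
lemma abs_medianChain_succ_sub (V : ℝ) (U : ℕ → ℝ) (j : ℕ) :
    |medianChain V U (j + 1) - medianChain V U j|
      = |medianChain V U j - V| - |medianChain V U (j + 1) - V| := by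
  simp only [medianChain, median]
  grind

lemma sum_abs_medianChain_le (V : ℝ) (U : ℕ → ℝ) (n : ℕ) :
    ∑ j ∈ Finset.range n, |medianChain V U (j + 1) - medianChain V U j| ≤ |U 0 - V| := by
  simp only [abs_medianChain_succ_sub]
  rw [Finset.sum_range_sub' fun j => |medianChain V U j - V|]
  have := abs_nonneg (medianChain V U n - V)
  simp only [medianChain]
  linarith

/-- Where the chain moves, it is squeezed between consecutive values of `U`. -/
lemma abs_sub_le_of_mem_uIcc_medianChain {V : ℝ} {U : ℕ → ℝ} {j : ℕ} {s : ℝ}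
    (h : medianChain V U (j + 1) ≠ medianChain V U j)
    (hs : s ∈ uIcc (medianChain V U j) (medianChain V U (j + 1))) :
    |U (j + 1) - s| ≤ |U (j + 1) - U j| := by
  -- Let U_j ≤ M_j ≤ V, the other case being symmetric. The chain moves only if U_{j+1} > M_j, and
  -- then M_{j+1} = min(U_{j+1}, V), so the segment swept lies in [U_j, U_{j+1}].
  have hm := medianChain_mem_uIcc V U j
  simp only [medianChain, median, mem_uIcc] at *
  grind

/-! ### Integration by parts in time and integrals over moving intervals. -/

/-- Integration by parts shifts the derivative onto H, with |H'| ≤ K almost everywhere. H is only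
assumed Lipschitz because medians have corners; P will be the integral of φ over a cell's section.
-/
lemma abs_integral_deriv_mul_le {a b K : ℝ} (hab : a ≤ b) {P P' H : ℝ → ℝ}
    (hPc : ContinuousOn P (Icc a b)) (hP : ∀ t ∈ Ioo a b, HasDerivAt P (P' t) t)
    (hP' : ContinuousOn P' (Icc a b)) (hPa : P a = 0) (hPb : P b = 0)
    (hH : ∀ s ∈ Icc a b, ∀ t ∈ Icc a b, |H t - H s| ≤ K * |t - s|) :
    |∫ t in a..b, P' t * H t| ≤ K * ∫ t in a..b, |P t| := by
  rcases hab.eq_or_lt with rfl | hlt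
  · simp
  have hK : 0 ≤ K := by
    have := (abs_nonneg _).trans (hH a (left_mem_Icc.2 hab) b (right_mem_Icc.2 hab))
    exact nonneg_of_mul_nonneg_left this (abs_pos.2 (by linarith))
  have hHlip : LipschitzOnWith K.toNNReal H (uIcc a b) := by
    refine LipschitzOnWith.of_dist_le_mul fun x hx y hy => ?_
    rw [uIcc_of_le hab] at hx hy
    simpa [Real.dist_eq, hK] using hH y hy x hx
  obtain ⟨C, hC⟩ := isCompact_Icc.exists_bound_of_continuousOn hP'
  have hPlip : LipschitzOnWith C.toNNReal P (uIcc a b) := by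
    rw [uIcc_of_le hab]
    refine LipschitzOnWith.of_dist_le_mul fun x hx y hy => ?_
    have key : ∀ x ∈ Icc a b, ∀ y ∈ Icc a b, x < y → |P y - P x| ≤ C * (y - x) := by
      intro x hx y hy hxy
      obtain ⟨c, hc, hc'⟩ := exists_hasDerivAt_eq_slope P P' hxy
        (hPc.mono (Icc_subset_Icc hx.1 hy.2)) fun t ht =>
          hP t ⟨hx.1.trans_lt ht.1, ht.2.trans_le hy.2⟩
      have h1 := hC c ⟨hx.1.trans hc.1.le, hc.2.le.trans hy.2⟩
      rw [hc', Real.norm_eq_abs, abs_div, abs_of_pos (sub_pos.2 hxy),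
        div_le_iff₀ (sub_pos.2 hxy)] at h1
      exact h1
    have hC0 : 0 ≤ C := (norm_nonneg _).trans (hC a (left_mem_Icc.2 hab))
    rw [Real.dist_eq, Real.dist_eq, Real.coe_toNNReal _ hC0]
    rcases lt_trichotomy x y with h | h | h
    · rw [abs_sub_comm, abs_sub_comm x, abs_of_pos (sub_pos.2 h)]
      exact key x hx y hy h
    · simp [h]
    · rw [abs_of_pos (sub_pos.2 h)]
      exact key y hy x hx h
  have hae : ∀ᵐ t, t ∈ uIoc a b → P' t * H t = deriv P t * H t := by
    have : ∀ᵐ t : ℝ, t ≠ b := by simp [ae_iff]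
    filter_upwards [this] with t htb ht
    rw [uIoc_of_le hab] at ht
    rw [(hP t ⟨ht.1, lt_of_le_of_ne ht.2 htb⟩).deriv]
  rw [intervalIntegral.integral_congr_ae hae]
  have hibp := AbsolutelyContinuousOnInterval.integral_mul_deriv_eq_deriv_mul
    hPlip.absolutelyContinuousOnInterval hHlip.absolutelyContinuousOnInterval
  rw [hPa, hPb] at hibp
  have hEq : ∫ t in a..b, deriv P t * H t = - ∫ t in a..b, P t * deriv H t := by linarith
  rw [hEq, abs_neg, ← intervalIntegral.integral_const_mul]
  refine (intervalIntegral.abs_integral_le_integral_abs hab).trans ?_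
  rw [intervalIntegral.integral_of_le hab, intervalIntegral.integral_of_le hab,
    integral_Ioc_eq_integral_Ioo, integral_Ioc_eq_integral_Ioo]
  refine integral_mono_of_nonneg (ae_of_all _ fun _ => abs_nonneg _) ?_ ?_
  · exact ((continuousOn_const.mul hPc.abs).integrableOn_Icc).mono_set Ioo_subset_Icc_self
  · refine (ae_restrict_iff' measurableSet_Ioo).2 (ae_of_all _ fun t ht => ?_)
    have : ‖deriv H t‖ ≤ K.toNNReal :=
      norm_deriv_le_of_lipschitzOn (Icc_mem_nhds ht.1 ht.2) (by rwa [uIcc_of_le hab] at hHlip)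
    rw [Real.coe_toNNReal _ hK, Real.norm_eq_abs] at this
    simp only [abs_mul]
    rw [mul_comm]
    gcongr

/-- The derivative of an integral over a moving interval. -/
lemma hasDerivAt_integral_moving {φ : ℝ × ℝ → ℝ} (hφ : ContDiff ℝ 1 φ) {α β : ℝ → ℝ}
    {α' β' t : ℝ} (hα : HasDerivAt α α' t) (hβ : HasDerivAt β β' t) :
    HasDerivAt (fun s => ∫ x in α s..β s, φ (s, x))
      ((∫ x in α t..β t, fderiv ℝ φ (t, x) (1, 0)) + (φ (t, β t) * β' - φ (t, α t) * α')) t := by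
  have hφc : Continuous φ := hφ.continuous
  have hdφ : Continuous fun p => fderiv ℝ φ p (1, 0) :=
    (hφ.continuous_fderiv one_ne_zero).clm_apply continuous_const
  have hsec : ∀ s, Continuous fun x => φ (s, x) := fun s => by fun_prop
  -- With the lower end fixed, (s, c) ↦ ∫₀ᶜ φ(s, x) dx has continuous partial derivatives, hence is
  -- differentiable, and the chain rule applies along s ↦ (s, γ s).
  have key : ∀ {γ : ℝ → ℝ} {γ' : ℝ}, HasDerivAt γ γ' t →
      HasDerivAt (fun s => ∫ x in (0 : ℝ)..γ s, φ (s, x))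
        ((∫ x in (0 : ℝ)..γ t, fderiv ℝ φ (t, x) (1, 0)) + φ (t, γ t) * γ') t := by
    intro γ γ' hγ
    have hd1 : ∀ v : ℝ × ℝ, HasDerivAt (fun s => ∫ x in (0 : ℝ)..v.2, φ (s, x))
        (∫ x in (0 : ℝ)..v.2, fderiv ℝ φ (v.1, x) (1, 0)) v.1 := by
      intro v
      obtain ⟨C, hC⟩ := ((isCompact_closedBall v.1 1).prod
        (isCompact_uIcc (a := (0 : ℝ)) (b := v.2))).exists_bound_of_continuousOn hdφ.continuousOn
      refine (intervalIntegral.hasDerivAt_integral_of_dominated_loc_of_deriv_le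
        (F := fun s x => φ (s, x)) (F' := fun s x => fderiv ℝ φ (s, x) (1, 0))
        (bound := fun _ => C) (Metric.closedBall_mem_nhds v.1 one_pos)
        (Filter.Eventually.of_forall fun s => (hsec s).aestronglyMeasurable)
        ((hsec _).intervalIntegrable _ _) ?_ ?_ intervalIntegrable_const ?_).2
      · exact (hdφ.comp (by fun_prop : Continuous fun x : ℝ => (v.1, x))).aestronglyMeasurable
      · exact ae_of_all _ fun x hx s hs => hC (s, x) ⟨hs, uIoc_subset_uIcc hx⟩
      · refine ae_of_all _ fun x _ s _ => ?_
        have h := ((hφ.differentiable one_ne_zero) (s, x)).hasFDerivAt.comp_hasDerivAt s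
          ((hasDerivAt_id s).prodMk (hasDerivAt_const s x))
        exact h
    have hd2 : ∀ v : ℝ × ℝ, HasDerivAt (fun c => ∫ x in (0 : ℝ)..c, φ (v.1, x)) (φ v) v.2 :=
      fun v => intervalIntegral.integral_hasDerivAt_right ((hsec _).intervalIntegrable _ _)
        (hsec _).aestronglyMeasurable.stronglyMeasurableAtFilter (hsec _).continuousAt
    have hc1 : Continuous fun v : ℝ × ℝ => ∫ x in (0 : ℝ)..v.2, fderiv ℝ φ (v.1, x) (1, 0) :=
      intervalIntegral.continuous_parametric_intervalIntegral_of_continuous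
        (f := fun (v : ℝ × ℝ) x => fderiv ℝ φ (v.1, x) (1, 0))
        (hdφ.comp (by fun_prop : Continuous fun z : (ℝ × ℝ) × ℝ => (z.1.1, z.2))) continuous_snd
    have hF := hasStrictFDerivAt_uncurry_coprod (𝕜 := ℝ) (u := (t, γ t))
      (f := fun s c => ∫ x in (0 : ℝ)..c, φ (s, x))
      (f₁ := fun s c => ContinuousLinearMap.toSpanSingleton ℝ
        (∫ x in (0 : ℝ)..c, fderiv ℝ φ (s, x) (1, 0)))
      (f₂ := fun s c => ContinuousLinearMap.toSpanSingleton ℝ (φ (s, c)))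
      (Filter.Eventually.of_forall fun v => (hd1 v).hasFDerivAt)
      (Filter.Eventually.of_forall fun v => (hd2 v).hasFDerivAt)
      ((ContinuousLinearMap.toSpanSingletonCLE (𝕜 := ℝ) (E := ℝ)).continuous.comp hc1).continuousAt
      ((ContinuousLinearMap.toSpanSingletonCLE (𝕜 := ℝ) (E := ℝ)).continuous.comp hφc).continuousAt
    have h := hF.hasFDerivAt.comp_hasDerivAt t ((hasDerivAt_id t).prodMk hγ)
    refine h.congr_deriv ?_
    simp [Function.HasUncurry.uncurry, mul_comm]
  refine (((key hβ).sub (key hα)).congr_deriv ?_).congr_of_eventuallyEq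
    (Filter.Eventually.of_forall fun s => ?_)
  · have hi : ∀ c, IntervalIntegrable (fun x => fderiv ℝ φ (t, x) (1, 0)) volume 0 c := fun c =>
      (hdφ.comp (by fun_prop : Continuous fun x : ℝ => (t, x))).intervalIntegrable _ _
    rw [← intervalIntegral.integral_interval_sub_left (hi (β t)) (hi (α t))]
    ring
  · exact (intervalIntegral.integral_interval_sub_left ((hsec _).intervalIntegrable _ _)
      ((hsec _).intervalIntegrable _ _)).symm

/-! ### The entropy balance on one time section. -/

/-- On a segment along which `deriv f` is within `κ` of `F`, the flux increment is `F` times the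
entropy increment up to a small error. -/
lemma IsEntropyPair.abs_mul_sub_sub_le {f η q : ℝ → ℝ} (h : IsEntropyPair f η q)
    {F c κ m m' : ℝ} (hc : ∀ s ∈ uIcc m m', |deriv η s| ≤ c)
    (hκ : ∀ s ∈ uIcc m m', |F - deriv f s| ≤ κ) :
    |F * (η m' - η m) - (q m' - q m)| ≤ c * κ * |m' - m| := by
  have hη : Differentiable ℝ η := h.entropy_smooth.differentiable one_ne_zero
  have hq : Differentiable ℝ q := h.flux_smooth.differentiable one_ne_zero
  have hd : ∀ s ∈ uIcc m m', HasDerivWithinAt (fun s => F * η s - q s)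
      (F * deriv η s - deriv η s * deriv f s) (uIcc m m') s := by
    intro s _
    rw [← h.deriv_flux]
    exact (((hη s).hasDerivAt.const_mul F).sub (hq s).hasDerivAt).hasDerivWithinAt
  have hb : ∀ s ∈ uIcc m m', ‖F * deriv η s - deriv η s * deriv f s‖ ≤ c * κ := by
    intro s hs
    rw [show F * deriv η s - deriv η s * deriv f s = deriv η s * (F - deriv f s) by ring,
      Real.norm_eq_abs, abs_mul]
    exact mul_le_mul (hc s hs) (hκ s hs) (abs_nonneg _) ((abs_nonneg _).trans (hc s hs))
  have := (convex_uIcc m m').norm_image_sub_le_of_norm_hasDerivWithin_le hd hb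
    left_mem_uIcc right_mem_uIcc
  simp only [Real.norm_eq_abs] at this
  convert! this using 2
  ring

/-- Summation by parts on a partitioned interval: with the values of `v` in the `j`-th cell replaced
by those of the median chain, the cell balances add up to the balance of the whole interval. -/
lemma IsEntropyPair.abs_sum_sub_balance_le {f η q : ℝ → ℝ} (h : IsEntropyPair f η q)
    {ψ ψ' θ v : ℝ → ℝ} (hψ : ∀ x, HasDerivAt ψ (ψ' x) x) (hψ' : Continuous ψ')
    (hθ : Continuous θ) (hv : Continuous v) {n : ℕ} {X : ℕ → ℝ} (hX : Monotone X)
    {B c κ δ ε m₀ m₁ m₂ : ℝ} (hB : ∀ x, |ψ x| ≤ B) (hB' : ∀ x, |ψ' x| ≤ B) (hθB : ∀ x, |θ x| ≤ B)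
    (hrange : ∀ x ∈ Icc (X 0) (X n), v x ∈ Icc m₁ m₂)
    (hosc : ∀ x ∈ Icc (X 0) (X n), |v x - m₀| ≤ δ)
    (hmod : ∀ s ∈ Icc m₁ m₂, ∀ s' ∈ Icc m₁ m₂, |s - s'| ≤ 2 * δ →
      |η s - η s'| ≤ ε ∧ |q s - q s'| ≤ ε)
    (hc : ∀ s ∈ Icc m₁ m₂, |deriv η s| ≤ c)
    (hκ : ∀ j < n, ∀ s ∈ Icc m₁ m₂, |v (X (j + 1)) - s| ≤ |v (X (j + 1)) - v (X j)| →
      |deriv f (v (X (j + 1))) - deriv f s| ≤ κ) (hκ0 : 0 ≤ κ) :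
    |∑ j ∈ Finset.range n, ((∫ x in X j..X (j + 1), θ x) +
          (ψ (X (j + 1)) * deriv f (v (X (j + 1))) - ψ (X j) * deriv f (v (X j)))) *
            η (medianChain (v (X n)) (fun i => v (X i)) j) -
        ((∫ x in X 0..X n, (θ x * η (v x) + ψ' x * q (v x))) +
          (ψ (X n) * (η (v (X n)) * deriv f (v (X n)) - q (v (X n))) -
            ψ (X 0) * (η (v (X 0)) * deriv f (v (X 0)) - q (v (X 0)))))|
      ≤ 2 * B * ε * (X n - X 0) + B * c * κ * |v (X 0) - v (X n)| := by
  set M : ℕ → ℝ := medianChain (v (X n)) (fun i => v (X i)) with hM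
  set F : ℕ → ℝ := fun j => deriv f (v (X j)) with hF
  have hηc : Continuous η := h.entropy_smooth.continuous
  have hqc : Continuous q := h.flux_smooth.continuous
  have hB0 : 0 ≤ B := (abs_nonneg _).trans (hB 0)
  have hXmem : ∀ i ≤ n, X i ∈ Icc (X 0) (X n) := fun i hi => ⟨hX (Nat.zero_le i), hX hi⟩
  have hMrange : ∀ j ≤ n, M j ∈ Icc m₁ m₂ := fun j hj =>
    medianChain_mem_Icc (hrange _ (hXmem n le_rfl)) j fun i hi => hrange _ (hXmem i (hi.trans hj))
  -- The chain stays in the hull of values of v, so it differs from v by at most 2δ; this is the 2δ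
  -- in `hmod`.
  have hMosc : ∀ j ≤ n, |M j - m₀| ≤ δ := by
    intro j hj
    have : M j ∈ Icc (m₀ - δ) (m₀ + δ) := by
      refine medianChain_mem_Icc ?_ j fun i hi => ?_
      · have := abs_le.1 (hosc _ (hXmem n le_rfl)); constructor <;> linarith
      · have := abs_le.1 (hosc _ (hXmem i (hi.trans hj))); constructor <;> linarith
    exact abs_le.2 ⟨by linarith [this.1], by linarith [this.2]⟩
  have hcont : Continuous fun x => θ x * η (v x) + ψ' x * q (v x) := by fun_prop
  have hsplit : ∫ x in X 0..X n, (θ x * η (v x) + ψ' x * q (v x)) =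
      ∑ j ∈ Finset.range n, ∫ x in X j..X (j + 1), (θ x * η (v x) + ψ' x * q (v x)) :=
    (intervalIntegral.sum_integral_adjacent_intervals fun j _ =>
      hcont.intervalIntegrable _ _).symm
  -- The chain starts at v(X 0) and ends at its target v(X n), so the side terms of the interval are
  -- those of the chain and telescope.
  have hends : ψ (X n) * (η (v (X n)) * F n - q (v (X n))) -
      ψ (X 0) * (η (v (X 0)) * F 0 - q (v (X 0))) =
      ∑ j ∈ Finset.range n, (ψ (X (j + 1)) * (η (M (j + 1)) * F (j + 1) - q (M (j + 1))) -
        ψ (X j) * (η (M j) * F j - q (M j))) := by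
    rw [Finset.sum_range_sub fun j => ψ (X j) * (η (M j) * F j - q (M j))]
    have hn : M n = v (X n) := medianChain_eq_last (fun i => v (X i)) n
    rw [hn]
    rfl
  have hterm : ∀ j ∈ Finset.range n,
      |((∫ x in X j..X (j + 1), θ x) + (ψ (X (j + 1)) * F (j + 1) - ψ (X j) * F j)) * η (M j) -
        ((∫ x in X j..X (j + 1), (θ x * η (v x) + ψ' x * q (v x))) +
          (ψ (X (j + 1)) * (η (M (j + 1)) * F (j + 1) - q (M (j + 1))) -
            ψ (X j) * (η (M j) * F j - q (M j))))|
      ≤ 2 * B * ε * (X (j + 1) - X j) + B * c * κ * |M (j + 1) - M j| := by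
    intro j hj
    have hj := Finset.mem_range.1 hj
    have hle : X j ≤ X (j + 1) := hX (Nat.le_succ j)
    have hftc : ∫ x in X j..X (j + 1), ψ' x = ψ (X (j + 1)) - ψ (X j) :=
      intervalIntegral.integral_eq_sub_of_hasDerivAt (fun x _ => hψ x)
        (hψ'.intervalIntegrable _ _)
    have hint : ∫ x in X j..X (j + 1),
        (θ x * (η (M j) - η (v x)) + ψ' x * (q (M j) - q (v x))) =
        (∫ x in X j..X (j + 1), θ x) * η (M j) + (ψ (X (j + 1)) - ψ (X j)) * q (M j) -
        ∫ x in X j..X (j + 1), (θ x * η (v x) + ψ' x * q (v x)) := by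
      rw [← hftc, ← intervalIntegral.integral_mul_const, ← intervalIntegral.integral_mul_const,
        ← intervalIntegral.integral_add
          (Continuous.intervalIntegrable (by fun_prop) _ _)
          (Continuous.intervalIntegrable (by fun_prop) _ _),
        ← intervalIntegral.integral_sub
          (Continuous.intervalIntegrable (by fun_prop) _ _)
          (Continuous.intervalIntegrable (by fun_prop) _ _)]
      congr 1
      ext x
      ring
    have hI : |∫ x in X j..X (j + 1),
        (θ x * (η (M j) - η (v x)) + ψ' x * (q (M j) - q (v x)))| ≤
        2 * B * ε * (X (j + 1) - X j) := by
      have := intervalIntegral.norm_integral_le_of_norm_le_const (a := X j) (b := X (j + 1))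
        (C := 2 * B * ε)
        (f := fun x => θ x * (η (M j) - η (v x)) + ψ' x * (q (M j) - q (v x))) ?_
      · rwa [abs_of_nonneg (sub_nonneg.2 hle), Real.norm_eq_abs] at this
      · intro x hx
        rw [uIoc_of_le hle] at hx
        have hx' : x ∈ Icc (X 0) (X n) :=
          ⟨(hXmem j hj.le).1.trans hx.1.le, hx.2.trans (hXmem (j + 1) hj).2⟩
        have hd : |M j - v x| ≤ 2 * δ := by
          have h1 := abs_le.1 (hMosc j hj.le)
          have h2 := abs_le.1 (hosc x hx')
          exact abs_le.2 ⟨by linarith, by linarith⟩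
        obtain ⟨h1, h2⟩ := hmod _ (hMrange j hj.le) _ (hrange x hx') hd
        rw [Real.norm_eq_abs]
        calc _ ≤ |θ x| * |η (M j) - η (v x)| + |ψ' x| * |q (M j) - q (v x)| := by
              rw [← abs_mul, ← abs_mul]; exact abs_add_le _ _
          _ ≤ B * ε + B * ε := by
              gcongr
              · exact hθB x
              · exact hB' x
          _ = 2 * B * ε := by ring
    have hJ : |F (j + 1) * (η (M (j + 1)) - η (M j)) - (q (M (j + 1)) - q (M j))| ≤
        c * κ * |M (j + 1) - M j| := by
      by_cases hne : M (j + 1) = M j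
      · simp [hne]
      have hsub : uIcc (M j) (M (j + 1)) ⊆ Icc m₁ m₂ :=
        uIcc_subset_Icc (hMrange j hj.le) (hMrange (j + 1) hj)
      exact h.abs_mul_sub_sub_le (fun s hs => hc s (hsub hs)) fun s hs =>
        hκ j hj s (hsub hs) (abs_sub_le_of_mem_uIcc_medianChain (U := fun i => v (X i)) hne hs)
    -- Summation by parts: since the integral of ψ' is the increment of ψ, all that survives at the
    -- node j + 1 is the defect F Δη − Δq, small because q' = η' f'.
    have hid : ((∫ x in X j..X (j + 1), θ x) +
          (ψ (X (j + 1)) * F (j + 1) - ψ (X j) * F j)) * η (M j) -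
        ((∫ x in X j..X (j + 1), (θ x * η (v x) + ψ' x * q (v x))) +
          (ψ (X (j + 1)) * (η (M (j + 1)) * F (j + 1) - q (M (j + 1))) -
            ψ (X j) * (η (M j) * F j - q (M j)))) =
        (∫ x in X j..X (j + 1), (θ x * (η (M j) - η (v x)) + ψ' x * (q (M j) - q (v x)))) -
        ψ (X (j + 1)) * (F (j + 1) * (η (M (j + 1)) - η (M j)) - (q (M (j + 1)) - q (M j))) := by
      rw [hint]; ring
    rw [hid]
    refine (abs_sub _ _).trans (add_le_add hI ?_)
    rw [abs_mul]
    calc _ ≤ B * (c * κ * |M (j + 1) - M j|) :=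
          mul_le_mul (hB _) hJ (abs_nonneg _) hB0
      _ = _ := by ring
  rw [hsplit, hends, ← Finset.sum_add_distrib, ← Finset.sum_sub_distrib]
  refine (Finset.abs_sum_le_sum_abs _ _).trans ((Finset.sum_le_sum hterm).trans ?_)
  rw [Finset.sum_add_distrib, ← Finset.mul_sum, ← Finset.mul_sum, Finset.sum_range_sub X]
  have hc0 : 0 ≤ c := (abs_nonneg _).trans (hc _ (hMrange 0 (Nat.zero_le n)))
  have := sum_abs_medianChain_le (v (X n)) (fun i => v (X i)) n
  gcongr

/-! ### Strips between characteristics. -/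

lemma continuous_integral_moving {ψ : ℝ × ℝ → ℝ} (hψ : Continuous ψ) {α β : ℝ → ℝ}
    (hα : Continuous α) (hβ : Continuous β) : Continuous fun t => ∫ x in α t..β t, ψ (t, x) := by
  have key : ∀ {γ : ℝ → ℝ}, Continuous γ → Continuous fun t => ∫ x in (0 : ℝ)..γ t, ψ (t, x) :=
    fun hγ => intervalIntegral.continuous_parametric_intervalIntegral_of_continuous
      (f := fun t x => ψ (t, x)) hψ hγ
  have hi : ∀ t c, IntervalIntegrable (fun x => ψ (t, x)) volume 0 c := fun t c =>
    (hψ.comp (by fun_prop : Continuous fun x : ℝ => (t, x))).intervalIntegrable _ _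
  refine ((key hβ).sub (key hα)).congr fun t => ?_
  exact intervalIntegral.integral_interval_sub_left (hi t _) (hi t _)

/-- Equispaced partition points of `[y₀, y₁]`. -/
noncomputable def gridPoint (y₀ y₁ : ℝ) (n j : ℕ) : ℝ := y₀ + j / n * (y₁ - y₀)

lemma gridPoint_zero (y₀ y₁ : ℝ) (n : ℕ) : gridPoint y₀ y₁ n 0 = y₀ := by simp [gridPoint]

lemma gridPoint_self {n : ℕ} (hn : n ≠ 0) (y₀ y₁ : ℝ) : gridPoint y₀ y₁ n n = y₁ := by
  have : (n : ℝ) ≠ 0 := by exact_mod_cast hn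
  simp [gridPoint, this]

lemma gridPoint_monotone {y₀ y₁ : ℝ} (h : y₀ ≤ y₁) (n : ℕ) : Monotone (gridPoint y₀ y₁ n) := by
  intro i j hij
  have : 0 ≤ y₁ - y₀ := sub_nonneg.2 h
  unfold gridPoint
  gcongr

lemma gridPoint_mem_Icc {y₀ y₁ : ℝ} (h : y₀ ≤ y₁) {n j : ℕ} (hn : n ≠ 0) (hj : j ≤ n) :
    gridPoint y₀ y₁ n j ∈ Icc y₀ y₁ :=
  ⟨(gridPoint_zero y₀ y₁ n).symm.le.trans (gridPoint_monotone h n (Nat.zero_le j)),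
    (gridPoint_monotone h n hj).trans (gridPoint_self hn y₀ y₁).le⟩

lemma gridPoint_succ_sub (y₀ y₁ : ℝ) (n j : ℕ) :
    gridPoint y₀ y₁ n (j + 1) - gridPoint y₀ y₁ n j = (y₁ - y₀) / n := by
  simp only [gridPoint]
  push_cast
  ring

/-- A continuous function oscillates little in the second variable on the cells of a fine grid. -/
lemma exists_gridPoint_osc_le {U : ℝ × ℝ → ℝ} (hU : Continuous U) {a b y₀ y₁ δ : ℝ}
    (hy : y₀ ≤ y₁) (hδ : 0 < δ) : ∃ n : ℕ, n ≠ 0 ∧ ∀ t ∈ Icc a b, ∀ j < n,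
      ∀ y ∈ Icc (gridPoint y₀ y₁ n j) (gridPoint y₀ y₁ n (j + 1)),
        |U (t, y) - U (t, gridPoint y₀ y₁ n j)| ≤ δ := by
  have huc := (isCompact_Icc.prod isCompact_Icc).uniformContinuousOn_of_continuous
    (s := Icc a b ×ˢ Icc y₀ y₁) hU.continuousOn
  obtain ⟨r, hr, hUr⟩ := Metric.uniformContinuousOn_iff.1 huc δ hδ
  obtain ⟨n, hn⟩ := exists_nat_gt ((y₁ - y₀) / r)
  have hn0 : (0 : ℝ) < n := (div_nonneg (sub_nonneg.2 hy) hr.le).trans_lt hn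
  have hn' : n ≠ 0 := by rintro rfl; simp at hn0
  refine ⟨n, hn', fun t ht j hj y hyj => ?_⟩
  have h1 := gridPoint_mem_Icc hy hn' hj.le
  have h2 := gridPoint_mem_Icc hy hn' (j := j + 1) hj
  have hstep : y - gridPoint y₀ y₁ n j < r := by
    have := gridPoint_succ_sub y₀ y₁ n j
    have h3 : (y₁ - y₀) / n < r := by
      rw [div_lt_iff₀ hr] at hn
      rw [div_lt_iff₀ hn0]
      linarith
    linarith [hyj.2]
  have := hUr (t, y) ⟨ht, h1.1.trans hyj.1, hyj.2.trans h2.2⟩ (t, gridPoint y₀ y₁ n j) ⟨ht, h1⟩ (by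
    rw [Prod.dist_eq, dist_self, Real.dist_eq, abs_of_nonneg (sub_nonneg.2 hyj.1)]
    exact max_lt hr hstep)
  exact (Real.dist_eq _ _ ▸ this).le

/-- The entropy balance of `u` on the strip between two curves of `χ`, up to the oscillation of `u`
across the strip. -/
lemma IsEntropyPair.abs_strip_balance_le {f η q : ℝ → ℝ} (hf : Continuous (deriv f))
    (h : IsEntropyPair f η q) {u : ℝ × ℝ → ℝ} (hu : Continuous u) {χ : ℝ → ℝ → ℝ}
    (hχ : Continuous fun p : ℝ × ℝ => χ p.1 p.2) (hmono : ∀ t, Monotone (χ t))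
    {a b y₀ y₁ G c m₁ m₂ B δ ε : ℝ} (hab : a ≤ b) (hy : y₀ ≤ y₁)
    (hder : ∀ t ∈ Ioo a b, ∀ y ∈ Icc y₀ y₁,
      HasDerivAt (fun s => χ s y) (deriv f (u (t, χ t y))) t)
    (hlip : ∀ y ∈ Icc y₀ y₁, ∀ s ∈ Icc a b, ∀ t ∈ Icc a b,
      |u (t, χ t y) - u (s, χ s y)| ≤ G * |t - s|)
    (hrange : ∀ t ∈ Icc a b, ∀ x ∈ Icc (χ t y₀) (χ t y₁), u (t, x) ∈ Icc m₁ m₂)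
    (hosc : ∀ t ∈ Icc a b, ∀ x ∈ Icc (χ t y₀) (χ t y₁), |u (t, x) - u (t, χ t y₀)| ≤ δ)
    (hmod : ∀ s ∈ Icc m₁ m₂, ∀ s' ∈ Icc m₁ m₂, |s - s'| ≤ 2 * δ →
      |η s - η s'| ≤ ε ∧ |q s - q s'| ≤ ε)
    (hc : ∀ s ∈ Icc m₁ m₂, |deriv η s| ≤ c)
    {φ : ℝ × ℝ → ℝ} (hφ : ContDiff ℝ 1 φ) (hφa : ∀ x, φ (a, x) = 0) (hφb : ∀ x, φ (b, x) = 0)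
    (hB : ∀ p, |φ p| ≤ B) (hBt : ∀ p, |fderiv ℝ φ p (1, 0)| ≤ B)
    (hBx : ∀ p, |fderiv ℝ φ p (0, 1)| ≤ B) :
    |∫ t in a..b, ((∫ x in χ t y₀..χ t y₁,
          (fderiv ℝ φ (t, x) (1, 0) * η (u (t, x)) + fderiv ℝ φ (t, x) (0, 1) * q (u (t, x)))) +
        (φ (t, χ t y₁) * (η (u (t, χ t y₁)) * deriv f (u (t, χ t y₁)) - q (u (t, χ t y₁))) -
          φ (t, χ t y₀) * (η (u (t, χ t y₀)) * deriv f (u (t, χ t y₀)) - q (u (t, χ t y₀)))))|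
      ≤ c * G * (∫ t in a..b, ∫ x in χ t y₀..χ t y₁, |φ (t, x)|) +
        2 * B * ε * ∫ t in a..b, (χ t y₁ - χ t y₀) := by
  have hη : Differentiable ℝ η := h.entropy_smooth.differentiable one_ne_zero
  have hηc : Continuous η := hη.continuous
  have hqc : Continuous q := h.flux_smooth.continuous
  have hφc : Continuous φ := hφ.continuous
  have hφt : Continuous fun p => fderiv ℝ φ p (1, 0) :=
    (hφ.continuous_fderiv one_ne_zero).clm_apply continuous_const
  have hφx : Continuous fun p => fderiv ℝ φ p (0, 1) :=
    (hφ.continuous_fderiv one_ne_zero).clm_apply continuous_const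
  have hχy : ∀ y, Continuous fun t => χ t y := fun y =>
    hχ.comp (by fun_prop : Continuous fun t : ℝ => (t, y))
  have hUy : ∀ y, Continuous fun t => u (t, χ t y) := fun y =>
    hu.comp (continuous_id.prodMk (hχy y))
  have hφy : ∀ y, Continuous fun t => φ (t, χ t y) := fun y =>
    hφc.comp (continuous_id.prodMk (hχy y))
  have hm : u (a, χ a y₀) ∈ Icc m₁ m₂ :=
    hrange a (left_mem_Icc.2 hab) _ (left_mem_Icc.2 (hmono a hy))
  have hc0 : 0 ≤ c := (abs_nonneg _).trans (hc _ hm)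
  have hB0 : 0 ≤ B := (abs_nonneg _).trans (hB 0)
  have hχmem : ∀ t, ∀ y ∈ Icc y₀ y₁, χ t y ∈ Icc (χ t y₀) (χ t y₁) := fun t y hy' =>
    ⟨hmono t hy'.1, hmono t hy'.2⟩
  set T : ℝ → ℝ := fun t => (∫ x in χ t y₀..χ t y₁,
          (fderiv ℝ φ (t, x) (1, 0) * η (u (t, x)) + fderiv ℝ φ (t, x) (0, 1) * q (u (t, x)))) +
        (φ (t, χ t y₁) * (η (u (t, χ t y₁)) * deriv f (u (t, χ t y₁)) - q (u (t, χ t y₁))) -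
          φ (t, χ t y₀) * (η (u (t, χ t y₀)) * deriv f (u (t, χ t y₀)) - q (u (t, χ t y₀))))
    with hT
  have hTc : Continuous T := by
    refine Continuous.add (continuous_integral_moving (ψ := fun p => fderiv ℝ φ p (1, 0) * η (u p) +
      fderiv ℝ φ p (0, 1) * q (u p)) (by fun_prop) (hχy _) (hχy _)) ?_
    have h0 := hUy y₀
    have h1 := hUy y₁
    have h2 := hφy y₀
    have h3 := hφy y₁
    fun_prop
  have habsc : Continuous fun t => ∫ x in χ t y₀..χ t y₁, |φ (t, x)| :=
    continuous_integral_moving (ψ := fun p => |φ p|) (by fun_prop) (hχy _) (hχy _)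
  -- Dκ is the total node error over time, the variation of the chain being at most m₂ − m₁. D does
  -- not depend on the grid, so κ can be fixed before n.
  set D : ℝ := B * c * (m₂ - m₁) * (b - a) with hD
  have hD0 : 0 ≤ D := by
    have : 0 ≤ m₂ - m₁ := by linarith [hm.1, hm.2]
    have : 0 ≤ b - a := sub_nonneg.2 hab
    positivity
  refine le_of_forall_pos_le_add fun e he => ?_
  set κ : ℝ := e / (D + 1) with hκ
  have hκ0 : 0 < κ := by positivity
  obtain ⟨r, hr, hfr⟩ := Metric.uniformContinuousOn_iff.1
    ((isCompact_Icc (a := m₁) (b := m₂)).uniformContinuousOn_of_continuous hf.continuousOn) κ hκ0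
  -- Neighbouring values of u differ by at most r/2, so on the segment swept by a step of the chain
  -- `deriv f` stays within κ of its value at the new node.
  obtain ⟨n, hn, hgrid⟩ := exists_gridPoint_osc_le (U := fun p => u (p.1, χ p.1 p.2))
    (by fun_prop) (a := a) (b := b) hy (half_pos hr)
  set z := gridPoint y₀ y₁ n with hz
  have hz0 : z 0 = y₀ := gridPoint_zero y₀ y₁ n
  have hzn : z n = y₁ := gridPoint_self hn y₀ y₁
  have hzmono : Monotone z := gridPoint_monotone hy n
  have hzmem : ∀ j ≤ n, z j ∈ Icc y₀ y₁ := fun j hj => gridPoint_mem_Icc hy hn hj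
  set H : ℕ → ℝ → ℝ := fun j t =>
    η (medianChain (u (t, χ t (z n))) (fun i => u (t, χ t (z i))) j) with hH
  set P' : ℕ → ℝ → ℝ := fun j t => (∫ x in χ t (z j)..χ t (z (j + 1)), fderiv ℝ φ (t, x) (1, 0)) +
    (φ (t, χ t (z (j + 1))) * deriv f (u (t, χ t (z (j + 1)))) -
      φ (t, χ t (z j)) * deriv f (u (t, χ t (z j)))) with hP'
  have hP'c : ∀ j, Continuous (P' j) := by
    intro j
    refine Continuous.add (continuous_integral_moving hφt (hχy _) (hχy _)) ?_
    have h0 := hUy (z j)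
    have h1 := hUy (z (j + 1))
    have h2 := hφy (z j)
    have h3 := hφy (z (j + 1))
    fun_prop
  have hHlip : ∀ j ≤ n, ∀ s ∈ Icc a b, ∀ t ∈ Icc a b, |H j t - H j s| ≤ c * G * |t - s| := by
    intro j hj s hs t ht
    have hmem : ∀ t ∈ Icc a b,
        medianChain (u (t, χ t (z n))) (fun i => u (t, χ t (z i))) j ∈ Icc m₁ m₂ := fun t ht =>
      medianChain_mem_Icc (hrange t ht _ (hχmem t _ (hzmem n le_rfl))) j fun i hi =>
        hrange t ht _ (hχmem t _ (hzmem i (hi.trans hj)))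
    have h1 := (convex_Icc m₁ m₂).norm_image_sub_le_of_norm_deriv_le (f := η)
      (fun x _ => hη x) hc (hmem s hs) (hmem t ht)
    refine h1.trans ?_
    rw [mul_assoc]
    refine mul_le_mul_of_nonneg_left ?_ hc0
    exact abs_medianChain_sub_le (hlip _ (hzmem n le_rfl) s hs t ht) j fun i hi =>
      hlip _ (hzmem i (hi.trans hj)) s hs t ht
  have hHc : ∀ j ≤ n, ContinuousOn (H j) (Icc a b) := by
    intro j hj
    have hl : LipschitzOnWith (c * G).toNNReal (H j) (Icc a b) :=
      LipschitzOnWith.of_dist_le_mul fun x hx y hy => by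
        rw [Real.dist_eq, Real.dist_eq]
        refine (hHlip j hj y hy x hx).trans ?_
        gcongr
        exact Real.le_coe_toNNReal _
    exact hl.continuousOn
  have hPj : ∀ j ∈ Finset.range n, |∫ t in a..b, P' j t * H j t| ≤
      c * G * ∫ t in a..b, |∫ x in χ t (z j)..χ t (z (j + 1)), φ (t, x)| := by
    intro j hj
    have hj := Finset.mem_range.1 hj
    refine abs_integral_deriv_mul_le hab
      (continuous_integral_moving hφc (hχy _) (hχy _)).continuousOn (fun t ht => ?_)
      (hP'c j).continuousOn (by simp [hφa]) (by simp [hφb]) (hHlip j hj.le)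
    exact hasDerivAt_integral_moving hφ (hder t ht _ (hzmem j hj.le)) (hder t ht _ (hzmem _ hj))
  -- The Lipschitz bound forces G ≥ 0 only when a < b; for a = b all integrals vanish.
  have hcG : 0 ≤ c * G ∨ a = b := by
    rcases hab.eq_or_lt with h | h
    · exact Or.inr h
    · refine Or.inl (mul_nonneg hc0 ?_)
      have := (abs_nonneg _).trans
        (hlip y₀ (left_mem_Icc.2 hy) a (left_mem_Icc.2 hab) b (right_mem_Icc.2 hab))
      exact nonneg_of_mul_nonneg_left this (abs_pos.2 (by linarith))
  rcases hcG with hcG | rfl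
  swap
  · simp [he.le]
  have hsum : |∫ t in a..b, ∑ j ∈ Finset.range n, P' j t * H j t| ≤
      c * G * ∫ t in a..b, ∫ x in χ t y₀..χ t y₁, |φ (t, x)| := by
    rw [intervalIntegral.integral_finsetSum (f := fun j t => P' j t * H j t) fun j hj =>
      ContinuousOn.intervalIntegrable_of_Icc hab
      ((hP'c j).continuousOn.mul (hHc j (Finset.mem_range.1 hj).le))]
    refine (Finset.abs_sum_le_sum_abs _ _).trans ((Finset.sum_le_sum hPj).trans ?_)
    rw [← Finset.mul_sum]
    refine mul_le_mul_of_nonneg_left ?_ hcG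
    have hPc : ∀ j, Continuous fun t => |∫ x in χ t (z j)..χ t (z (j + 1)), φ (t, x)| := fun j =>
      (continuous_integral_moving hφc (hχy _) (hχy _)).abs
    rw [← intervalIntegral.integral_finsetSum fun j _ => (hPc j).intervalIntegrable _ _]
    refine intervalIntegral.integral_mono_on hab
      ((continuous_finsetSum _ fun j _ => hPc j).intervalIntegrable _ _)
      (habsc.intervalIntegrable _ _) fun t _ => ?_
    have hsec : Continuous fun x => |φ (t, x)| := by fun_prop
    rw [← hz0, ← hzn, ← intervalIntegral.sum_integral_adjacent_intervals
      (a := fun j => χ t (z j)) fun j _ => hsec.intervalIntegrable _ _]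
    exact Finset.sum_le_sum fun j _ =>
      intervalIntegral.abs_integral_le_integral_abs (hmono t (hzmono (Nat.le_succ j)))
  have hdiff : ∀ t ∈ Icc a b, |∑ j ∈ Finset.range n, P' j t * H j t - T t| ≤
      2 * B * ε * (χ t y₁ - χ t y₀) + B * c * κ * (m₂ - m₁) := by
    intro t ht
    have hX : Monotone fun j => χ t (z j) := (hmono t).comp hzmono
    have hψ : ∀ x, HasDerivAt (fun x => φ (t, x)) (fderiv ℝ φ (t, x) (0, 1)) x := fun x =>
      ((hφ.differentiable one_ne_zero) (t, x)).hasFDerivAt.comp_hasDerivAt x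
        ((hasDerivAt_const x t).prodMk (hasDerivAt_id x))
    have hpair : Continuous fun x : ℝ => (t, x) := by fun_prop
    have := h.abs_sum_sub_balance_le (ψ := fun x => φ (t, x))
      (ψ' := fun x => fderiv ℝ φ (t, x) (0, 1)) (θ := fun x => fderiv ℝ φ (t, x) (1, 0))
      (v := fun x => u (t, x)) hψ (hφx.comp hpair) (hφt.comp hpair) (hu.comp hpair)
      (n := n) (X := fun j => χ t (z j)) hX (B := B) (c := c) (κ := κ) (δ := δ) (ε := ε)
      (m₀ := u (t, χ t y₀)) (m₁ := m₁) (m₂ := m₂)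
      (fun x => hB _) (fun x => hBx _) (fun x => hBt _)
      (by rw [hz0, hzn]; exact hrange t ht) (by rw [hz0, hzn]; exact hosc t ht) hmod hc
      (fun j hj s hs hsU => by
        have h1 := hgrid t ht j hj (z (j + 1)) ⟨hzmono (Nat.le_succ j), le_rfl⟩
        have h2 := hfr _ (hrange t ht _ (hχmem t _ (hzmem (j + 1) hj))) s hs
          (by rw [Real.dist_eq]; linarith [hsU.trans h1])
        exact (Real.dist_eq _ _ ▸ h2).le) hκ0.le
    rw [hz0, hzn] at this
    have hU : |u (t, χ t y₀) - u (t, χ t y₁)| ≤ m₂ - m₁ := by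
      have h0 := hrange t ht _ (hχmem t y₀ (left_mem_Icc.2 hy))
      have h1 := hrange t ht _ (hχmem t y₁ (right_mem_Icc.2 hy))
      exact abs_le.2 ⟨by linarith [h0.1, h1.2], by linarith [h0.2, h1.1]⟩
    simp only [hH, hP', hT, hzn]
    refine this.trans ?_
    gcongr
  have hSc : ContinuousOn (fun t => ∑ j ∈ Finset.range n, P' j t * H j t) (Icc a b) :=
    continuousOn_finsetSum _ fun j hj =>
      (hP'c j).continuousOn.mul (hHc j (Finset.mem_range.1 hj).le)
  have hSi := hSc.intervalIntegrable_of_Icc (μ := volume) hab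
  have hTi : IntervalIntegrable T volume a b := hTc.intervalIntegrable _ _
  have hwidth : Continuous fun t => χ t y₁ - χ t y₀ := (hχy _).sub (hχy _)
  have hint : |(∫ t in a..b, ∑ j ∈ Finset.range n, P' j t * H j t) - ∫ t in a..b, T t| ≤
      2 * B * ε * (∫ t in a..b, (χ t y₁ - χ t y₀)) + D * κ := by
    rw [← intervalIntegral.integral_sub hSi hTi]
    refine (intervalIntegral.abs_integral_le_integral_abs hab).trans ?_
    refine (intervalIntegral.integral_mono_on hab (hSi.sub hTi).abs
      (Continuous.intervalIntegrable (by fun_prop) _ _) hdiff).trans_eq ?_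
    rw [intervalIntegral.integral_add (Continuous.intervalIntegrable (by fun_prop) _ _)
      intervalIntegrable_const, intervalIntegral.integral_const_mul,
      intervalIntegral.integral_const, smul_eq_mul, hD]
    ring
  have hDκ : D * κ ≤ e := by
    rw [hκ, mul_div_assoc', div_le_iff₀ (by positivity)]
    nlinarith
  have h1 := abs_le.1 hsum
  have h2 := abs_le.1 hint
  exact abs_le.2 ⟨by linarith [h1.1, h2.2], by linarith [h1.2, h2.1]⟩

/-- The entropy balance of `u` tested against functions that vanish near the boundary of the strip
`{a ≤ t ≤ b, χ t y₀ ≤ x ≤ χ t y₁}`. -/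
lemma IsEntropyPair.abs_integral_strip_le {f η q : ℝ → ℝ} (hf : Continuous (deriv f))
    (h : IsEntropyPair f η q) {u : ℝ × ℝ → ℝ} (hu : Continuous u) {χ : ℝ → ℝ → ℝ}
    (hχ : Continuous fun p : ℝ × ℝ => χ p.1 p.2) (hmono : ∀ t, Monotone (χ t))
    {a b y₀ y₁ G c m₁ m₂ : ℝ} (hab : a ≤ b) (hy : y₀ ≤ y₁)
    (hder : ∀ t ∈ Ioo a b, ∀ y ∈ Icc y₀ y₁,
      HasDerivAt (fun s => χ s y) (deriv f (u (t, χ t y))) t)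
    (hlip : ∀ y ∈ Icc y₀ y₁, ∀ s ∈ Icc a b, ∀ t ∈ Icc a b,
      |u (t, χ t y) - u (s, χ s y)| ≤ G * |t - s|)
    (hrange : ∀ t ∈ Icc a b, ∀ x ∈ Icc (χ t y₀) (χ t y₁), u (t, x) ∈ Icc m₁ m₂)
    (hc : ∀ s ∈ Icc m₁ m₂, |deriv η s| ≤ c)
    {φ : ℝ × ℝ → ℝ} (hφ : ContDiff ℝ 1 φ) (hφs : HasCompactSupport φ)
    (hφa : ∀ x, φ (a, x) = 0) (hφb : ∀ x, φ (b, x) = 0)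
    (hφ₀ : ∀ t ∈ Icc a b, φ (t, χ t y₀) = 0) (hφ₁ : ∀ t ∈ Icc a b, φ (t, χ t y₁) = 0) :
    |∫ t in a..b, ∫ x in χ t y₀..χ t y₁,
        (fderiv ℝ φ (t, x) (1, 0) * η (u (t, x)) + fderiv ℝ φ (t, x) (0, 1) * q (u (t, x)))|
      ≤ c * G * ∫ t in a..b, ∫ x in χ t y₀..χ t y₁, |φ (t, x)| := by
  have hηc : Continuous η := h.entropy_smooth.continuous
  have hqc : Continuous q := h.flux_smooth.continuous
  have hφc : Continuous φ := hφ.continuous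
  have hfd : Continuous (fderiv ℝ φ) := hφ.continuous_fderiv one_ne_zero
  have hφt : Continuous fun p => fderiv ℝ φ p (1, 0) := hfd.clm_apply continuous_const
  have hφx : Continuous fun p => fderiv ℝ φ p (0, 1) := hfd.clm_apply continuous_const
  obtain ⟨B₀, hB₀⟩ := hφs.exists_bound_of_continuous hφc
  obtain ⟨B₁, hB₁⟩ := (hφs.fderiv_apply (𝕜 := ℝ) (v := (1, 0))).exists_bound_of_continuous hφt
  obtain ⟨B₂, hB₂⟩ := (hφs.fderiv_apply (𝕜 := ℝ) (v := (0, 1))).exists_bound_of_continuous hφx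
  set B := max B₀ (max B₁ B₂) with hBdef
  have hB0 : 0 ≤ B := ((norm_nonneg _).trans (hB₀ 0)).trans (le_max_left _ _)
  have hχy : ∀ y, Continuous fun t => χ t y := fun y =>
    hχ.comp (by fun_prop : Continuous fun t : ℝ => (t, y))
  set W : ℝ := ∫ t in a..b, (χ t y₁ - χ t y₀) with hW
  have hW0 : 0 ≤ W := intervalIntegral.integral_nonneg hab fun t _ => sub_nonneg.2 (hmono t hy)
  refine le_of_forall_pos_le_add fun e he => ?_
  set ε : ℝ := e / (2 * B * W + 1) with hε
  have hε0 : 0 < ε := by positivity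
  obtain ⟨r₁, hr₁, hηr⟩ := Metric.uniformContinuousOn_iff.1
    ((isCompact_Icc (a := m₁) (b := m₂)).uniformContinuousOn_of_continuous hηc.continuousOn) ε hε0
  obtain ⟨r₂, hr₂, hqr⟩ := Metric.uniformContinuousOn_iff.1
    ((isCompact_Icc (a := m₁) (b := m₂)).uniformContinuousOn_of_continuous hqc.continuousOn) ε hε0
  -- A third, so that 2δ is strictly below both moduli of continuity.
  set δ : ℝ := min r₁ r₂ / 3 with hδ
  have hδ0 : 0 < δ := by positivity
  have hδ₁ : 2 * δ < r₁ := by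
    have := min_le_left r₁ r₂
    linarith [hδ0]
  have hδ₂ : 2 * δ < r₂ := by
    have := min_le_right r₁ r₂
    linarith [hδ0]
  obtain ⟨n, hn, hgrid⟩ := exists_gridPoint_osc_le (U := fun p => u (p.1, χ p.1 p.2))
    (by fun_prop) (a := a) (b := b) hy hδ0
  set z := gridPoint y₀ y₁ n with hz
  have hz0 : z 0 = y₀ := gridPoint_zero y₀ y₁ n
  have hzn : z n = y₁ := gridPoint_self hn y₀ y₁
  have hzmono : Monotone z := gridPoint_monotone hy n
  have hzmem : ∀ j ≤ n, z j ∈ Icc y₀ y₁ := fun j hj => gridPoint_mem_Icc hy hn hj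
  set ψ : ℝ × ℝ → ℝ := fun p =>
    fderiv ℝ φ p (1, 0) * η (u p) + fderiv ℝ φ p (0, 1) * q (u p) with hψ
  have hψc : Continuous ψ := by fun_prop
  set E : ℝ → ℝ → ℝ := fun y t => φ (t, χ t y) *
    (η (u (t, χ t y)) * deriv f (u (t, χ t y)) - q (u (t, χ t y))) with hE
  have hEc : ∀ y, Continuous (E y) := by
    intro y
    have h0 : Continuous fun t => u (t, χ t y) := hu.comp (continuous_id.prodMk (hχy y))
    have h1 : Continuous fun t => φ (t, χ t y) := hφc.comp (continuous_id.prodMk (hχy y))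
    fun_prop
  have hstrip : ∀ j ∈ Finset.range n,
      |∫ t in a..b, ((∫ x in χ t (z j)..χ t (z (j + 1)), ψ (t, x)) +
        (E (z (j + 1)) t - E (z j) t))| ≤
      c * G * (∫ t in a..b, ∫ x in χ t (z j)..χ t (z (j + 1)), |φ (t, x)|) +
        2 * B * ε * ∫ t in a..b, (χ t (z (j + 1)) - χ t (z j)) := by
    intro j hj
    have hj := Finset.mem_range.1 hj
    have hle : z j ≤ z (j + 1) := hzmono (Nat.le_succ j)
    have hsub : Icc (z j) (z (j + 1)) ⊆ Icc y₀ y₁ :=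
      Icc_subset_Icc (hzmem j hj.le).1 (hzmem (j + 1) hj).2
    refine h.abs_strip_balance_le hf hu hχ hmono (δ := δ) hab hle
      (fun t ht y hy => hder t ht y (hsub hy)) (fun y hy => hlip y (hsub hy))
      (m₁ := m₁) (m₂ := m₂) (fun t ht x hx => hrange t ht x ?_) (fun t ht x hx => ?_)
      (fun s hs s' hs' hss => ?_) hc hφ hφa hφb (fun p => ?_) (fun p => ?_) (fun p => ?_)
    · exact ⟨(hmono t (hzmem j hj.le).1).trans hx.1, hx.2.trans (hmono t (hzmem (j + 1) hj).2)⟩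
    -- By continuity in y, each point between two neighbouring curves lies on an intermediate curve,
    -- so the grid estimate in y controls the oscillation in x.
    · obtain ⟨y, hyj, rfl⟩ := intermediate_value_Icc hle
        (hχ.comp (by fun_prop : Continuous fun y : ℝ => (t, y))).continuousOn hx
      exact hgrid t ht j hj y hyj
    · rw [← Real.dist_eq] at hss
      rw [← Real.dist_eq, ← Real.dist_eq]
      exact ⟨(hηr s hs s' hs' (hss.trans_lt hδ₁)).le, (hqr s hs s' hs' (hss.trans_lt hδ₂)).le⟩
    · exact (hB₀ p).trans (le_max_left _ _)
    · exact (hB₁ p).trans ((le_max_left _ _).trans (le_max_right _ _))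
    · exact (hB₂ p).trans ((le_max_right _ _).trans (le_max_right _ _))
  have hsplit : ∀ {θ : ℝ × ℝ → ℝ}, Continuous θ →
      ∑ j ∈ Finset.range n, ∫ t in a..b, ∫ x in χ t (z j)..χ t (z (j + 1)), θ (t, x) =
        ∫ t in a..b, ∫ x in χ t y₀..χ t y₁, θ (t, x) := by
    intro θ hθ
    rw [← intervalIntegral.integral_finsetSum fun j _ =>
      (continuous_integral_moving hθ (hχy _) (hχy _)).intervalIntegrable _ _]
    refine intervalIntegral.integral_congr fun t _ => ?_
    have hθt : Continuous fun x => θ (t, x) := by fun_prop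
    rw [intervalIntegral.sum_integral_adjacent_intervals (a := fun j => χ t (z j)) fun j _ =>
      hθt.intervalIntegrable _ _, hz0, hzn]
  have hwidth : ∑ j ∈ Finset.range n, ∫ t in a..b, (χ t (z (j + 1)) - χ t (z j)) = W := by
    rw [← intervalIntegral.integral_finsetSum (f := fun j t => χ t (z (j + 1)) - χ t (z j))
      fun j _ => ((hχy _).sub (hχy _)).intervalIntegrable _ _]
    refine intervalIntegral.integral_congr fun t _ => ?_
    rw [Finset.sum_range_sub fun j => χ t (z j), hz0, hzn]
  -- Terms on interior curves cancel between adjacent strips, and φ vanishes on the two outer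
  -- curves.
  have hends : ∑ j ∈ Finset.range n, ∫ t in a..b, (E (z (j + 1)) t - E (z j) t) = 0 := by
    simp only [intervalIntegral.integral_sub ((hEc _).intervalIntegrable _ _)
      ((hEc _).intervalIntegrable _ _)]
    rw [Finset.sum_range_sub fun j => ∫ t in a..b, E (z j) t, hz0, hzn]
    have hzero : ∀ y, (∀ t ∈ Icc a b, φ (t, χ t y) = 0) → ∫ t in a..b, E y t = 0 := by
      intro y hy0
      rw [intervalIntegral.integral_congr (g := fun _ => 0) fun t ht => ?_]
      · simp
      · rw [uIcc_of_le hab] at ht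
        simp [hE, hy0 t ht]
    rw [hzero y₁ hφ₁, hzero y₀ hφ₀, sub_zero]
  have htotal : ∫ t in a..b, ∫ x in χ t y₀..χ t y₁, ψ (t, x) =
      ∑ j ∈ Finset.range n, ∫ t in a..b, ((∫ x in χ t (z j)..χ t (z (j + 1)), ψ (t, x)) +
        (E (z (j + 1)) t - E (z j) t)) := by
    rw [← hsplit hψc, ← add_zero (∑ j ∈ Finset.range n, _), ← hends, ← Finset.sum_add_distrib]
    refine Finset.sum_congr rfl fun j _ => ?_
    exact (intervalIntegral.integral_add
      ((continuous_integral_moving hψc (hχy _) (hχy _)).intervalIntegrable _ _)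
      (((hEc _).sub (hEc _)).intervalIntegrable _ _)).symm
  change |∫ t in a..b, ∫ x in χ t y₀..χ t y₁, ψ (t, x)| ≤ _
  rw [htotal]
  refine (Finset.abs_sum_le_sum_abs _ _).trans ((Finset.sum_le_sum hstrip).trans ?_)
  rw [Finset.sum_add_distrib, ← Finset.mul_sum, ← Finset.mul_sum, hwidth,
    hsplit (θ := fun p => |φ p|) hφc.abs]
  have : 2 * B * ε * W ≤ e := by
    rw [hε, show 2 * B * (e / (2 * B * W + 1)) * W = (2 * B * W) * e / (2 * B * W + 1) by ring,
      div_le_iff₀ (by positivity)]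
    nlinarith
  linarith

/-! ### Lipschitz bounds from bounded distributional derivatives. -/

lemma nonneg_of_ae_abs_le {T : Set ℝ} (hT : IsOpen T) (hne : T.Nonempty) {h : ℝ → ℝ} {G : ℝ}
    (hG : ∀ᵐ t ∂(volume.restrict T), |h t| ≤ G) : 0 ≤ G := by
  have : Filter.NeBot (ae (volume.restrict T)) := by
    rw [ae_neBot, Ne, Measure.restrict_eq_zero]
    exact (hT.measure_pos volume hne).ne'
  obtain ⟨x, hx⟩ := hG.exists
  exact (abs_nonneg _).trans hx

/-- A continuous function whose distributional derivative is bounded by `G` is `G`-Lipschitz on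
intervals. -/
lemma DistribDeriv.abs_sub_le {T : Set ℝ} (hT : IsOpen T) {v h : ℝ → ℝ} (hd : DistribDeriv T v h)
    (hv : ContinuousOn v T) {G : ℝ} (hG : ∀ᵐ t ∂(volume.restrict T), |h t| ≤ G) {a b : ℝ}
    (hab : Icc a b ⊆ T) : ∀ s ∈ Icc a b, ∀ t ∈ Icc a b, |v t - v s| ≤ G * |t - s| := by
  have key : ∀ s ∈ Icc a b, ∀ t ∈ Icc a b, s < t → |v t - v s| ≤ G * (t - s) := by
    intro s hs t ht hst
    have hsT : s ∈ T := hab hs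
    have htT : t ∈ T := hab ht
    have hG0 : 0 ≤ G := nonneg_of_ae_abs_le hT ⟨s, hsT⟩ hG
    -- The error is e for each of the two averages of v, near s and near t, and 2Ge for the test
    -- function overhanging [s, t] by r ≤ e on both sides.
    have hbound : ∀ e > 0, |v t - v s| ≤ G * (t - s) + (2 * G + 2) * e := by
      intro e he
      have hnear : ∀ x ∈ T, ∃ r > 0, Metric.ball x r ⊆ T ∧
          ∀ y ∈ Metric.ball x r, dist (v y) (v x) ≤ e := by
        intro x hx
        have h1 := hT.mem_nhds hx
        have h2 := (hv.continuousAt h1).eventually (Metric.closedBall_mem_nhds (v x) he)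
        obtain ⟨r, hr, hr'⟩ := Metric.mem_nhds_iff.1 (Filter.inter_mem h1 h2)
        exact ⟨r, hr, fun y hy => (hr' hy).1, fun y hy => (hr' hy).2⟩
      obtain ⟨r₁, hr₁, hT₁, hv₁⟩ := hnear s hsT
      obtain ⟨r₂, hr₂, hT₂, hv₂⟩ := hnear t htT
      set r : ℝ := min e (min r₁ r₂) / 2 with hr
      have hr0 : 0 < r := by positivity
      have hre : r ≤ e := by
        have := min_le_left e (min r₁ r₂)
        linarith [hr0]
      have hrr₁ : r < r₁ := by
        have := (min_le_right e (min r₁ r₂)).trans (min_le_left _ _)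
        linarith [hr0]
      have hrr₂ : r < r₂ := by
        have := (min_le_right e (min r₁ r₂)).trans (min_le_right _ _)
        linarith [hr0]
      let bump : ContDiffBump (0 : ℝ) := ⟨r / 2, r, by positivity, by linarith⟩
      set ρ : ℝ → ℝ := bump.normed volume with hρ
      have hρs : ContDiff ℝ ∞ ρ := bump.contDiff_normed
      have hρc : Continuous ρ := hρs.continuous
      have hρ0 : ∀ x, r ≤ |x| → ρ x = 0 := by
        intro x hx
        have : x ∉ Function.support ρ := by
          rw [hρ, bump.support_normed_eq]
          simpa [bump] using hx
        simpa using this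
      have hρint : ∫ x, ρ x = 1 := bump.integral_normed
      have hρi : Integrable ρ := bump.integrable_normed
      have hρnn : ∀ x, 0 ≤ ρ x := fun x => bump.nonneg_normed x
      have hρneg : ∀ x, ρ (-x) = ρ x := fun x => bump.normed_neg x
      -- This is the mollified indicator of [s, t]. Its derivative is the bump at s minus the bump
      -- at t, so testing with it compares averages of v near s and near t.
      set φ : ℝ → ℝ := fun x => ∫ y in (x - t)..(x - s), ρ y with hφ
      have hR : ∀ x, HasDerivAt (fun x => ∫ y in (0 : ℝ)..x, ρ y) (ρ x) x := fun x =>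
        hρc.integral_hasStrictDerivAt 0 x |>.hasDerivAt
      have hφd : ∀ x, HasDerivAt φ (ρ (x - s) - ρ (x - t)) x := by
        intro x
        have := ((hR (x - s)).comp_sub_const x s).sub ((hR (x - t)).comp_sub_const x t)
        refine this.congr_of_eventuallyEq (Filter.Eventually.of_forall fun y => ?_)
        exact (intervalIntegral.integral_interval_sub_left (hρc.intervalIntegrable _ _)
          (hρc.intervalIntegrable _ _)).symm
      have hφderiv : deriv φ = fun x => ρ (x - s) - ρ (x - t) := funext fun x => (hφd x).deriv
      have hφ01 : ∀ x, φ x ∈ Icc 0 1 := by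
        intro x
        have hle : x - t ≤ x - s := by linarith
        refine ⟨intervalIntegral.integral_nonneg hle fun y _ => hρnn y, ?_⟩
        rw [hφ]
        simp only
        rw [intervalIntegral.integral_of_le hle, ← hρint]
        exact setIntegral_le_integral hρi (ae_of_all _ hρnn)
      have hφ0 : ∀ x, x ∉ Icc (s - r) (t + r) → φ x = 0 := by
        intro x hx
        rw [hφ]
        simp only
        rw [intervalIntegral.integral_congr (g := fun _ => 0) fun y hy => ?_]
        · simp
        · rw [uIcc_of_le (by linarith)] at hy
          refine hρ0 y ?_
          rw [mem_Icc, not_and_or, not_le, not_le] at hx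
          rcases hx with hx | hx
          · exact (by linarith [hy.2] : r ≤ -y).trans (neg_le_abs y)
          · exact (by linarith [hy.1] : r ≤ y).trans (le_abs_self y)
      have hsupp : Icc (s - r) (t + r) ⊆ T := by
        intro x hx
        rcases lt_or_ge x s with h1 | h1
        · exact hT₁ (by rw [Metric.mem_ball, Real.dist_eq, abs_lt]; constructor <;> linarith [hx.1])
        rcases lt_or_ge t x with h2 | h2
        · exact hT₂ (by rw [Metric.mem_ball, Real.dist_eq, abs_lt]; constructor <;> linarith [hx.2])
        exact hab ⟨hs.1.trans h1, h2.trans ht.2⟩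
      set K : Set ℝ := Icc (s - r) (t + r) with hK
      have htest : IsTestFunction T φ := by
        refine ⟨?_, HasCompactSupport.intro isCompact_Icc hφ0,
          (closure_minimal (Function.support_subset_iff'.2 hφ0) isClosed_Icc).trans hsupp⟩
        rw [contDiff_infty_iff_deriv, hφderiv]
        exact ⟨fun x => (hφd x).differentiableAt, by fun_prop⟩
      have heq := hd φ htest
      -- v is controlled only on T; cutting it off makes it integrable on the line, as the
      -- convolution estimate needs.
      set w : ℝ → ℝ := K.indicator v with hw
      have hwi : Integrable w :=
        ((hv.mono hsupp).integrableOn_compact isCompact_Icc).integrable_indicator measurableSet_Icc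
      have hleft : ∫ x in T, deriv φ x * v x = (∫ x, ρ (x - s) * w x) - ∫ x, ρ (x - t) * w x := by
        have hoff : ∀ x ∉ K, deriv φ x = 0 := by
          intro x hx
          rw [hφderiv]
          simp only [hK, mem_Icc, not_and_or, not_le] at hx
          have h1 : r ≤ |x - s| := by
            rcases hx with hx | hx
            · exact (by linarith : r ≤ -(x - s)).trans (neg_le_abs _)
            · exact (by linarith : r ≤ x - s).trans (le_abs_self _)
          have h2 : r ≤ |x - t| := by
            rcases hx with hx | hx
            · exact (by linarith : r ≤ -(x - t)).trans (neg_le_abs _)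
            · exact (by linarith : r ≤ x - t).trans (le_abs_self _)
          simp [hρ0 _ h1, hρ0 _ h2]
        have hcongr : ∀ x, deriv φ x * v x = (ρ (x - s) - ρ (x - t)) * w x := by
          intro x
          by_cases hx : x ∈ K
          · rw [hw, indicator_of_mem hx, hφderiv]
          · rw [hw, indicator_of_notMem hx, hoff x hx, zero_mul, mul_zero]
        have hi : ∀ c : ℝ, Integrable fun x => ρ (x - c) * w x := by
          intro c
          obtain ⟨C, hC⟩ := bump.hasCompactSupport_normed (μ := volume)
            |>.exists_bound_of_continuous hρc
          exact hwi.bdd_mul (by fun_prop : Continuous fun x => ρ (x - c)).aestronglyMeasurable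
            (ae_of_all _ fun x => hC (x - c))
        rw [setIntegral_eq_integral_of_forall_compl_eq_zero fun x hx => by
          rw [hoff x fun h => hx (hsupp h), zero_mul], ← integral_sub (hi s) (hi t)]
        exact integral_congr_ae (ae_of_all _ fun x => (hcongr x).trans (sub_mul _ _ _))
      have hmoll : ∀ c ∈ Icc s t, (∀ y ∈ Metric.ball c r, dist (v y) (v c) ≤ e) →
          |(∫ x, ρ (x - c) * w x) - v c| ≤ e := by
        intro c hc hvc
        have hmem : ∀ y ∈ Metric.ball c r, w y = v y := by
          intro y hy
          rw [Metric.mem_ball, Real.dist_eq, abs_lt] at hy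
          exact indicator_of_mem (s := K) ⟨by linarith [hc.1], by linarith [hc.2]⟩ v
        have hcc := hmem c (Metric.mem_ball_self hr0)
        have h1 := bump.dist_normed_convolution_le (x₀ := c) (ε := e) hwi.aestronglyMeasurable
          fun y hy => by rw [hmem y hy, hcc]; exact hvc y hy
        rw [hcc, Real.dist_eq, convolution_eq_swap] at h1
        have hswap : ∀ x, ρ (x - c) = ρ (c - x) := fun x => by rw [← hρneg, neg_sub]
        simpa only [hswap, ContinuousLinearMap.lsmul_apply, smul_eq_mul] using h1
      have h1 := hmoll s ⟨le_rfl, hst.le⟩ fun y hy =>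
        hv₁ y (Metric.ball_subset_ball hrr₁.le hy)
      have h2 := hmoll t ⟨hst.le, le_rfl⟩ fun y hy =>
        hv₂ y (Metric.ball_subset_ball hrr₂.le hy)
      have h3 : |∫ x in T, φ x * h x| ≤ G * (t - s + 2 * e) := by
        have hKi : Integrable (K.indicator fun _ => G) (volume.restrict T) :=
          (integrableOn_const (by simp)).integrable_indicator measurableSet_Icc |>.integrableOn
        calc |∫ x in T, φ x * h x| ≤ ∫ x in T, |φ x * h x| := abs_integral_le_integral_abs
          _ ≤ ∫ x in T, K.indicator (fun _ => G) x := by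
              refine integral_mono_of_nonneg (ae_of_all _ fun _ => abs_nonneg _) hKi ?_
              filter_upwards [hG] with x hx
              by_cases hxK : x ∈ K
              · rw [indicator_of_mem hxK, abs_mul, abs_of_nonneg (hφ01 x).1]
                nlinarith [(hφ01 x).2, abs_nonneg (h x)]
              · rw [indicator_of_notMem hxK, hφ0 x hxK, zero_mul, abs_zero]
          _ = G * (t - s + 2 * r) := by
              rw [setIntegral_indicator measurableSet_Icc, inter_eq_right.2 hsupp,
                setIntegral_const, smul_eq_mul, hK, Real.volume_real_Icc_of_le (by linarith)]
              ring
          _ ≤ G * (t - s + 2 * e) := by gcongr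
      rw [hleft] at heq
      rw [← heq] at h3
      have h1 := abs_le.1 h1
      have h2 := abs_le.1 h2
      have h3 := abs_le.1 h3
      exact abs_le.2 ⟨by linarith [h1.1, h2.2, h3.2], by linarith [h1.2, h2.1, h3.1]⟩
    refine le_of_forall_pos_le_add fun e he => ?_
    refine (hbound (e / (2 * G + 2)) (by positivity)).trans_eq ?_
    rw [mul_div_cancel₀ _ (by positivity : 2 * G + 2 ≠ 0)]
  intro s hs t ht
  rcases lt_trichotomy s t with h | rfl | h
  · rw [abs_of_pos (sub_pos.2 h)]
    exact key s hs t ht h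
  · simp
  · rw [abs_sub_comm, abs_sub_comm t, abs_of_pos (sub_pos.2 h)]
    exact key t ht s hs h

/-! ### Functionals on test functions: localisation and Riesz representation. -/

lemma IsTestFunction.add {E : Type*} [NormedAddCommGroup E] [NormedSpace ℝ E] {U : Set E}
    {φ ψ : E → ℝ} (hφ : IsTestFunction U φ) (hψ : IsTestFunction U ψ) :
    IsTestFunction U (φ + ψ) :=
  ⟨hφ.smooth.add hψ.smooth, hφ.compact.add hψ.compact,
    (tsupport_add φ ψ).trans (union_subset hφ.supp hψ.supp)⟩

lemma IsTestFunction.const_smul {E : Type*} [NormedAddCommGroup E] [NormedSpace ℝ E] {U : Set E}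
    {φ : E → ℝ} (hφ : IsTestFunction U φ) (r : ℝ) : IsTestFunction U (r • φ) := by
  refine ⟨hφ.smooth.const_smul r, hφ.compact.smul_left, (closure_mono ?_).trans hφ.supp⟩
  exact Function.support_const_smul_subset r φ

lemma IsTestFunction.zero {E : Type*} [NormedAddCommGroup E] [NormedSpace ℝ E] (U : Set E) :
    IsTestFunction U (0 : E → ℝ) :=
  ⟨contDiff_const, HasCompactSupport.zero, by simp [tsupport]⟩

lemma IsTestFunction.mono {E : Type*} [NormedAddCommGroup E] [NormedSpace ℝ E] {U V : Set E}
    {φ : E → ℝ} (hφ : IsTestFunction U φ) (h : U ⊆ V) : IsTestFunction V φ :=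
  ⟨hφ.smooth, hφ.compact, hφ.supp.trans h⟩

lemma IsTestFunction.eq_zero {E : Type*} [NormedAddCommGroup E] [NormedSpace ℝ E] {U : Set E}
    {φ : E → ℝ} (hφ : IsTestFunction U φ) {x : E} (hx : x ∉ U) : φ x = 0 :=
  image_eq_zero_of_notMem_tsupport fun h => hx (hφ.supp h)

/-- A functional on test functions that is locally bounded by `K` times the `L¹` norm is globally
so. -/
lemma abs_le_of_locally_abs_le {E : Type*} [NormedAddCommGroup E] [NormedSpace ℝ E]
    [FiniteDimensional ℝ E] [MeasurableSpace E] [BorelSpace E] (μ : Measure E)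
    [IsFiniteMeasureOnCompacts μ] {Ω : Set E} {L : (E → ℝ) → ℝ} {K : ℝ}
    (hadd : ∀ φ ψ, IsTestFunction Ω φ → IsTestFunction Ω ψ → L (φ + ψ) = L φ + L ψ)
    (hzero : L 0 = 0)
    (hloc : ∀ p ∈ Ω, ∃ V, IsOpen V ∧ p ∈ V ∧ V ⊆ Ω ∧
      ∀ φ, IsTestFunction V φ → |L φ| ≤ K * ∫ x, |φ x| ∂μ)
    {φ : E → ℝ} (hφ : IsTestFunction Ω φ) : |L φ| ≤ K * ∫ x, |φ x| ∂μ := by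
  choose! V hVo hVp hVΩ hV using hloc
  -- The ρ_i are nonnegative with sum one on the support of φ, so the L¹ norms of the ρ_i φ add up
  -- to that of φ and the constant K is not worsened.
  obtain ⟨ρ, hρ⟩ := SmoothPartitionOfUnity.exists_isSubordinate (modelWithCornersSelf ℝ E)
    (isClosed_tsupport φ) (fun p : Ω => V p) (fun p => hVo p p.2)
    (fun x hx => mem_iUnion.2 ⟨⟨x, hφ.supp hx⟩, hVp x (hφ.supp hx)⟩)
  have hfin := ρ.locallyFinite.finite_nonempty_inter_compact hφ.compact
  set S : Finset Ω := hfin.toFinset with hS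
  have htest : ∀ i : Ω, IsTestFunction (V i) (fun x => ρ i x * φ x) := fun i =>
    ⟨(ρ i).contMDiff.contDiff.mul hφ.smooth, hφ.compact.mul_left,
      (tsupport_mul_subset_left (f := ρ i) (g := φ)).trans (hρ i)⟩
  have hone : ∀ x ∈ tsupport φ, ∑ i ∈ S, ρ i x = 1 := by
    intro x hx
    rw [← ρ.sum_eq_one hx]
    refine (finsum_eq_sum_of_support_subset _ fun i hi => ?_).symm
    exact hfin.mem_toFinset.2 ⟨x, hi, hx⟩
  have hsum : φ = ∑ i ∈ S, fun x => ρ i x * φ x := by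
    ext x
    rw [Finset.sum_apply, ← Finset.sum_mul]
    by_cases hx : x ∈ tsupport φ
    · rw [hone x hx, one_mul]
    · rw [image_eq_zero_of_notMem_tsupport hx, mul_zero]
  have hLsum : ∀ S' : Finset Ω, IsTestFunction Ω (∑ i ∈ S', fun x => ρ i x * φ x) ∧
      L (∑ i ∈ S', fun x => ρ i x * φ x) = ∑ i ∈ S', L (fun x => ρ i x * φ x) := by
    classical
    intro S'
    induction S' using Finset.induction_on with
    | empty => simpa [hzero] using IsTestFunction.zero Ω
    | insert i S' hi ih =>
      have hi' := (htest i).mono (hVΩ i i.2)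
      rw [Finset.sum_insert hi, Finset.sum_insert hi, hadd _ _ hi' ih.1, ih.2]
      exact ⟨hi'.add ih.1, rfl⟩
  have hint : ∀ i : Ω, Integrable (fun x => |ρ i x * φ x|) μ := fun i =>
    ((htest i).smooth.continuous.integrable_of_hasCompactSupport (htest i).compact).abs
  calc |L φ| = |∑ i ∈ S, L (fun x => ρ i x * φ x)| := by rw [← (hLsum S).2, ← hsum]
    _ ≤ ∑ i ∈ S, |L (fun x => ρ i x * φ x)| := Finset.abs_sum_le_sum_abs _ _
    _ ≤ ∑ i ∈ S, K * ∫ x, |ρ i x * φ x| ∂μ := Finset.sum_le_sum fun i _ => hV i i.2 _ (htest i)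
    _ = K * ∫ x, |φ x| ∂μ := by
      rw [← Finset.mul_sum, ← integral_finsetSum S fun i _ => hint i]
      congr 2
      ext x
      simp only [abs_mul, abs_of_nonneg (ρ.nonneg _ x)]
      rw [← Finset.sum_mul]
      by_cases hx : x ∈ tsupport φ
      · rw [hone x hx, one_mul]
      · rw [image_eq_zero_of_notMem_tsupport hx, abs_zero, mul_zero]

/-- Riesz representation for a functional given on the domain of a map `j` into a Hilbert space and
bounded by the norm of `j`. -/
lemma exists_eq_inner_of_abs_le {V H : Type*} [AddCommGroup V] [Module ℝ V] [NormedAddCommGroup H]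
    [InnerProductSpace ℝ H] [CompleteSpace H] (j : V →ₗ[ℝ] H) (T : V →ₗ[ℝ] ℝ) (C : ℝ)
    (hT : ∀ v, |T v| ≤ C * ‖j v‖) : ∃ h : H, ∀ v, T v = inner ℝ h (j v) := by
  -- The bound makes T vanish on the kernel of j, so T descends to the range of j. Hahn–Banach
  -- extends it to H, with no density or closedness of the range.
  have hker : LinearMap.ker j ≤ LinearMap.ker T := by
    intro v hv
    have := hT v
    rw [LinearMap.mem_ker.1 hv, norm_zero, mul_zero] at this
    exact LinearMap.mem_ker.2 (abs_nonpos_iff.1 this)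
  set T' : LinearMap.range j →ₗ[ℝ] ℝ :=
    ((LinearMap.ker j).liftQ T hker).comp j.quotKerEquivRange.symm.toLinearMap with hT'
  have hT'j : ∀ v, T' ⟨j v, LinearMap.mem_range_self j v⟩ = T v := by
    intro v
    have : j.quotKerEquivRange.symm ⟨j v, LinearMap.mem_range_self j v⟩ =
        Submodule.Quotient.mk v := by
      rw [LinearEquiv.symm_apply_eq]
      rfl
    simp [hT', this]
  obtain ⟨g, hg, -⟩ := exists_extension_norm_eq (LinearMap.range j) (T'.mkContinuous C (by
    rintro ⟨_, v, rfl⟩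
    rw [hT'j v]
    exact hT v))
  refine ⟨(InnerProductSpace.toDual ℝ H).symm g, fun v => ?_⟩
  rw [InnerProductSpace.toDual_symm_apply, ← hT'j v]
  exact (hg ⟨j v, LinearMap.mem_range_self j v⟩).symm

/-- The space of test functions on `U`. -/
def testFunctions {E : Type*} [NormedAddCommGroup E] [NormedSpace ℝ E] (U : Set E) :
    Submodule ℝ (E → ℝ) where
  carrier := {φ | IsTestFunction U φ}
  add_mem' := IsTestFunction.add
  zero_mem' := IsTestFunction.zero U
  smul_mem' r _ h := h.const_smul r

section Riesz

variable {E : Type*} [NormedAddCommGroup E] [NormedSpace ℝ E] [FiniteDimensional ℝ E]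
  [MeasurableSpace E] [BorelSpace E] {μ : Measure E} [μ.IsAddHaarMeasure]

/-- A locally integrable function that is bounded by `K` as a functional on `L¹` is bounded by `K`
almost everywhere. -/
lemma ae_abs_le_of_abs_integral_le {Ω : Set E} (hΩ : IsOpen Ω) {g : E → ℝ}
    (hg : LocallyIntegrable g μ) {K : ℝ}
    (h : ∀ φ, IsTestFunction Ω φ → |∫ x, φ x * g x ∂μ| ≤ K * ∫ x, |φ x| ∂μ) :
    ∀ᵐ x ∂(μ.restrict Ω), |g x| ≤ K := by
  let bump : ℕ → ContDiffBump (0 : E) := fun n =>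
    ⟨1 / (n + 1) / 2, 1 / (n + 1), by positivity, by
      have : (0 : ℝ) < 1 / (n + 1) := by positivity
      linarith⟩
  have hlim : Filter.Tendsto (fun n => (bump n).rOut) Filter.atTop (nhds 0) :=
    tendsto_one_div_add_atTop_nhds_zero_nat
  -- At almost every point g is the limit of its averages against normalised bumps, and these have
  -- L¹ norm one. The factor 2 is the ratio of outer to inner radius.
  have hconv := ContDiffBump.ae_convolution_tendsto_right_of_locallyIntegrable (μ := μ) (K := 2)
    hlim (Filter.Eventually.of_forall fun n => by simp only [bump]; linarith) hg
  refine (ae_restrict_iff' hΩ.measurableSet).2 ?_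
  filter_upwards [hconv] with p hp hpΩ
  refine le_of_tendsto hp.abs ?_
  obtain ⟨r, hr, hball⟩ := Metric.isOpen_iff.1 hΩ p hpΩ
  filter_upwards [hlim.eventually (gt_mem_nhds hr)] with n hn
  have htest : IsTestFunction Ω fun x => (bump n).normed μ (p - x) := by
    refine ⟨(bump n).contDiff_normed.comp (contDiff_const.sub contDiff_id),
      HasCompactSupport.intro (isCompact_closedBall p (bump n).rOut) fun x hx => ?_,
      (closure_minimal (Function.support_subset_iff'.2 fun x hx => ?_)
        (Metric.isClosed_closedBall (x := p) (ε := (bump n).rOut))).trans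
        ((Metric.closedBall_subset_ball hn).trans hball)⟩ <;>
    · have : p - x ∉ Function.support ((bump n).normed μ) := by
        rw [(bump n).support_normed_eq, Metric.mem_ball, dist_zero_right, not_lt]
        rw [Metric.mem_closedBall, dist_comm, dist_eq_norm, not_le] at hx
        exact hx.le
      simpa using this
  have h1 := h _ htest
  have h2 : ∫ x, |(bump n).normed μ (p - x)| ∂μ = 1 := by
    simp only [abs_of_nonneg ((bump n).nonneg_normed _)]
    rw [integral_sub_left_eq_self, (bump n).integral_normed]
  rw [h2, mul_one] at h1
  rw [convolution_eq_swap]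
  exact h1

/-- A linear functional on test functions that is bounded by `K` times the `L¹` norm is the
integral against a function bounded by `K`. -/
lemma exists_eq_integral_of_abs_le {Ω : Set E} (hΩ : IsOpen Ω) (L : testFunctions Ω →ₗ[ℝ] ℝ)
    {K : ℝ} (hK : 0 ≤ K) (hL : ∀ φ : testFunctions Ω, |L φ| ≤ K * ∫ x, |φ.1 x| ∂μ) :
    ∃ g : E → ℝ, LocallyIntegrable g μ ∧ (∀ᵐ x ∂(μ.restrict Ω), |g x| ≤ K) ∧
      ∀ φ : testFunctions Ω, L φ = ∫ x, φ.1 x * g x ∂μ := by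
  set d : ℝ := Module.finrank ℝ E + 1 with hd
  -- The exponent puts w in L², as d exceeds the dimension. By Cauchy–Schwarz ∫ |φ| ≤ ‖w‖₂ ‖φ/w‖₂,
  -- so the L¹ bound becomes a Hilbert space bound in φ/w, and F ∈ L² represents L through the
  -- density F/w.
  set w : E → ℝ := fun x => (1 + ‖x‖) ^ (-(d / 2)) with hw
  have hpos : ∀ x : E, 0 < 1 + ‖x‖ := fun x => by positivity
  have hw0 : ∀ x, 0 < w x := fun x => Real.rpow_pos_of_pos (hpos x) _
  have hwc : Continuous w :=
    (by fun_prop : Continuous fun x : E => 1 + ‖x‖).rpow_const fun x => Or.inl (hpos x).ne'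
  have hwinv : Continuous fun x => (w x)⁻¹ := hwc.inv₀ fun x => (hw0 x).ne'
  have hw2 : MemLp w 2 μ := by
    rw [memLp_two_iff_integrable_sq hwc.aestronglyMeasurable]
    refine (integrable_one_add_norm (μ := μ) (r := d) (by rw [hd]; linarith)).congr
      (ae_of_all _ fun x => ?_)
    simp only [hw]
    rw [← Real.rpow_natCast, ← Real.rpow_mul (hpos x).le]
    congr 1
    push_cast
    ring
  have hmem : ∀ φ : testFunctions Ω, MemLp (fun x => φ.1 x * (w x)⁻¹) 2 μ := fun φ =>
    (φ.2.smooth.continuous.mul hwinv).memLp_of_hasCompactSupport φ.2.compact.mul_right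
  let j : testFunctions Ω →ₗ[ℝ] Lp ℝ 2 μ :=
    { toFun := fun φ => (hmem φ).toLp _
      map_add' := fun φ ψ => by
        rw [← MemLp.toLp_add]
        congr 1
        ext x
        exact add_mul _ _ _
      map_smul' := fun r φ => by
        rw [RingHom.id_apply, ← MemLp.toLp_const_smul]
        congr 1
        ext x
        exact mul_assoc _ _ _ }
  have hinner : ∀ (F : Lp ℝ 2 μ) (φ : testFunctions Ω),
      inner ℝ F (j φ) = ∫ x, φ.1 x * ((w x)⁻¹ * F x) ∂μ := by
    intro F φ
    rw [L2.inner_def]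
    refine integral_congr_ae ?_
    filter_upwards [(hmem φ).coeFn_toLp] with x hx
    change inner ℝ (F x) ((hmem φ).toLp _ x) = _
    rw [hx]
    simp [mul_assoc]
  have hbound : ∀ φ, |L φ| ≤ K * ‖hw2.toLp w‖ * ‖j φ‖ := by
    intro φ
    refine (hL φ).trans ?_
    rw [mul_assoc]
    refine mul_le_mul_of_nonneg_left ?_ hK
    have habs : MemLp (fun x => |φ.1 x * (w x)⁻¹|) 2 μ := (hmem φ).abs
    have hn : ‖habs.toLp _‖ = ‖j φ‖ := by
      change _ = ‖(hmem φ).toLp _‖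
      rw [Lp.norm_toLp, Lp.norm_toLp]
      congr 1
      exact eLpNorm_norm (fun x => φ.1 x * (w x)⁻¹)
    rw [← hn]
    refine le_trans (le_of_eq ?_) (real_inner_le_norm (hw2.toLp w) (habs.toLp _))
    rw [L2.inner_def]
    refine integral_congr_ae ?_
    filter_upwards [hw2.coeFn_toLp, habs.coeFn_toLp] with x h1 h2
    rw [h1, h2, abs_mul, abs_of_pos (inv_pos.2 (hw0 x))]
    simp [(hw0 x).ne']
  obtain ⟨F, hF⟩ := exists_eq_inner_of_abs_le j L _ hbound
  have hFloc : LocallyIntegrable (fun x => (w x)⁻¹ * F x) μ := by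
    have h1 : LocallyIntegrable F μ := (Lp.memLp F).locallyIntegrable one_le_two
    rw [← locallyIntegrableOn_univ] at h1 ⊢
    exact h1.continuousOn_mul hwinv.continuousOn isOpen_univ.isLocallyClosed
  refine ⟨fun x => (w x)⁻¹ * F x, hFloc, ?_, fun φ => by rw [hF, hinner]⟩
  refine ae_abs_le_of_abs_integral_le hΩ hFloc fun φ hφ => ?_
  have h1 := hL ⟨φ, hφ⟩
  rwa [hF, hinner] at h1

end Riesz

/-! ### The local estimate for Lagrangian solutions. -/

/-- The pairing of the field `(a, b)` with the space-time gradient of `φ` over `Ω`. -/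
noncomputable def fluxPairing (Ω : Set (ℝ × ℝ)) (a b φ : ℝ × ℝ → ℝ) : ℝ :=
  ∫ p in Ω, (fderiv ℝ φ p (1, 0) * a p + fderiv ℝ φ p (0, 1) * b p)

lemma isOpen_curveTimes {f : ℝ → ℝ} {Ω : Set (ℝ × ℝ)} (hΩ : IsOpen Ω) (hΩ_sub : Ω ⊆ halfPlane)
    {u : ℝ × ℝ → ℝ} {χ : ℝ → ℝ → ℝ} (hχ : IsLagrangianParam f Ω u χ) (y : ℝ) :
    IsOpen (curveTimes Ω fun t => χ t y) := by
  have hc : ContinuousOn (fun t => (t, χ t y)) (Ioi 0) :=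
    continuousOn_id.prodMk (hχ.continuousOn.comp (f := fun t : ℝ => (t, y)) (by fun_prop)
      fun t ht => ⟨ht, mem_univ _⟩)
  have : curveTimes Ω (fun t => χ t y) = Ioi 0 ∩ (fun t => (t, χ t y)) ⁻¹' Ω := by
    ext t
    exact ⟨fun h => ⟨(hΩ_sub h).1, h⟩, fun h => h.2⟩
  rw [this]
  exact hc.isOpen_inter_preimage isOpen_Ioi hΩ

lemma continuousOn_curve {f : ℝ → ℝ} {Ω : Set (ℝ × ℝ)} (hΩ_sub : Ω ⊆ halfPlane)
    {u : ℝ × ℝ → ℝ} (hu : ContinuousOn u Ω) {χ : ℝ → ℝ → ℝ} (hχ : IsLagrangianParam f Ω u χ)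
    (y : ℝ) : ContinuousOn (fun t => u (t, χ t y)) (curveTimes Ω fun t => χ t y) := by
  have hc : ContinuousOn (fun t => (t, χ t y)) (Ioi 0) :=
    continuousOn_id.prodMk (hχ.continuousOn.comp (f := fun t : ℝ => (t, y)) (by fun_prop)
      fun t ht => ⟨ht, mem_univ _⟩)
  exact hu.comp (hc.mono fun t ht => (hΩ_sub ht).1) fun t ht => ht

lemma integral_eq_integral_strip {θ : ℝ × ℝ → ℝ} (hθ : Integrable θ) {a b : ℝ} (hab : a ≤ b)
    {α β : ℝ → ℝ} (hαβ : ∀ t, α t ≤ β t)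
    (h : ∀ p, ¬(p.1 ∈ Ioo a b ∧ p.2 ∈ Ioo (α p.1) (β p.1)) → θ p = 0) :
    ∫ p, θ p = ∫ t in a..b, ∫ x in α t..β t, θ (t, x) := by
  rw [Measure.volume_eq_prod] at hθ ⊢
  rw [integral_prod _ hθ, intervalIntegral.integral_of_le hab,
    ← setIntegral_eq_integral_of_forall_compl_eq_zero (s := Ioc a b) fun t ht => ?_]
  · refine integral_congr_ae (ae_of_all _ fun t => ?_)
    simp only
    rw [intervalIntegral.integral_of_le (hαβ t)]
    refine (setIntegral_eq_integral_of_forall_compl_eq_zero fun x hx => h _ fun hx' => ?_).symm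
    exact hx (Ioo_subset_Ioc_self hx'.2)
  · have : ∀ x, θ (t, x) = 0 := fun x => h _ fun hx' => ht (Ioo_subset_Ioc_self hx'.1)
    simp [this]

lemma IsTestFunction.fderiv_eq_zero {E : Type*} [NormedAddCommGroup E] [NormedSpace ℝ E] {U : Set E}
    {φ : E → ℝ} (hφ : IsTestFunction U φ) {x : E} (hx : x ∉ U) : fderiv ℝ φ x = 0 :=
  image_eq_zero_of_notMem_tsupport fun h => hx (hφ.supp (tsupport_fderiv_subset ℝ h))

/-- Every point of `Ω` has a neighbourhood, filled by curves of `χ` that stay in `Ω`, where the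
entropy production of `u` is bounded by `c * G` as a functional on `L¹`. -/
lemma IsLagrangianSolution.exists_nhds_abs_fluxPairing_le {f : ℝ → ℝ} (hf : Continuous (deriv f))
    {Ω : Set (ℝ × ℝ)} (hΩ : IsOpen Ω) (hΩ_sub : Ω ⊆ halfPlane) {u : ℝ × ℝ → ℝ} {χ : ℝ → ℝ → ℝ}
    {g : ℝ × ℝ → ℝ} (hu : IsLagrangianSolution f Ω u χ g) {G : ℝ}
    (hG : LagrangianSourceBound Ω χ g G) {p : ℝ × ℝ} (hp : p ∈ Ω) {m₁ m₂ : ℝ}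
    (hm : u p ∈ Ioo m₁ m₂) :
    ∃ V, IsOpen V ∧ p ∈ V ∧ V ⊆ Ω ∧ (∀ x ∈ V, u x ∈ Icc m₁ m₂) ∧
      ∀ η q c, IsEntropyPair f η q → (∀ s ∈ Icc m₁ m₂, |deriv η s| ≤ c) →
        ∀ φ, IsTestFunction V φ →
          |fluxPairing Ω (fun x => η (u x)) (fun x => q (u x)) φ| ≤ c * G * ∫ x, |φ x| := by
  obtain ⟨t₀, x₀⟩ := p
  obtain ⟨r, hr, hQ⟩ := Metric.nhds_basis_closedBall.mem_iff.1
    ((hu.continuousOn.isOpen_inter_preimage hΩ isOpen_Ioo).mem_nhds ⟨hp, hm⟩)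
  have hQmem : ∀ t x, |t - t₀| ≤ r → |x - x₀| ≤ r → (t, x) ∈ Ω ∧ u (t, x) ∈ Icc m₁ m₂ := by
    intro t x ht hx
    have := hQ (Metric.mem_closedBall.2
      (by rw [Prod.dist_eq, Real.dist_eq, Real.dist_eq]; exact max_le ht hx) :
        (t, x) ∈ Metric.closedBall (t₀, x₀) r)
    exact ⟨this.1, Ioo_subset_Icc_self this.2⟩
  have htr : 0 < t₀ - r :=
    (hΩ_sub (hQmem (t₀ - r) x₀ (by simp [abs_of_pos hr]) (by simp [hr.le])).1).1
  -- Clamping the time to [t₀ − r, t₀ + r], and below the position to [x₀ − r, x₀ + r], extends χ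
  -- and u continuously to the whole plane without changing them where the strip lives.
  set τ : ℝ → ℝ := fun t => max (t₀ - r) (min t (t₀ + r)) with hτ
  have hτc : Continuous τ := by fun_prop
  have hτ0 : ∀ t, 0 < τ t := fun t => htr.trans_le (le_max_left _ _)
  have hτeq : ∀ t, |t - t₀| ≤ r → τ t = t := by
    intro t ht
    have := abs_le.1 ht
    rw [hτ]
    simp only
    rw [min_eq_left (by linarith), max_eq_right (by linarith)]
  set ξ : ℝ → ℝ → ℝ := fun t y => χ (τ t) y with hξ
  have hξc : Continuous fun p : ℝ × ℝ => ξ p.1 p.2 :=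
    hu.param.continuousOn.comp_continuous (f := fun p : ℝ × ℝ => (τ p.1, p.2)) (by fun_prop)
      fun p => ⟨hτ0 _, mem_univ _⟩
  have hξmono : ∀ t, Monotone (ξ t) := fun t => hu.param.monotone _ (hτ0 t)
  have hξy : ∀ y, Continuous fun t => ξ t y := fun y =>
    hξc.comp (by fun_prop : Continuous fun t : ℝ => (t, y))
  have ht₀ : 0 < t₀ := by linarith
  have hξ₀ : ξ t₀ = χ t₀ := by
    ext y
    simp only [hξ]
    rw [hτeq t₀ (by simp [hr.le])]
  -- At time t₀ the curves labelled by [y₀, y₁] are within r/2 of x₀; by compactness of the label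
  -- interval they all stay within r for times near t₀, hence inside Ω.
  obtain ⟨y₀, hy₀⟩ := hu.param.surjective t₀ ht₀ (x₀ - r / 2)
  obtain ⟨y₁, hy₁⟩ := hu.param.surjective t₀ ht₀ (x₀ + r / 2)
  have hy : y₀ ≤ y₁ := by
    by_contra! hlt
    have := hu.param.monotone t₀ ht₀ hlt.le
    rw [hy₀, hy₁] at this
    linarith
  have hnear : IsOpen {p : ℝ × ℝ | |ξ p.1 p.2 - x₀| < r} :=
    isOpen_lt (by fun_prop) continuous_const
  obtain ⟨S, S', hSo, -, hS, hS', hSS⟩ := generalized_tube_lemma (isCompact_singleton (x := t₀))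
    (isCompact_Icc (a := y₀) (b := y₁)) hnear (by
      rintro ⟨t, y⟩ ⟨ht, hyy⟩
      have h1 := hu.param.monotone t₀ ht₀ hyy.1
      have h2 := hu.param.monotone t₀ ht₀ hyy.2
      rw [hy₀] at h1
      rw [hy₁] at h2
      change |ξ t y - x₀| < r
      rw [show t = t₀ from ht, hξ₀]
      exact abs_lt.2 ⟨by linarith, by linarith⟩)
  obtain ⟨k, hk, hkS⟩ := Metric.nhds_basis_closedBall.mem_iff.1
    (hSo.mem_nhds (hS (mem_singleton t₀)))
  set l : ℝ := min k r with hl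
  have hl0 : 0 < l := lt_min hk hr
  have hlr : l ≤ r := min_le_right _ _
  set a := t₀ - l with ha
  set b := t₀ + l with hb
  have hab : a ≤ b := by linarith
  have htime : ∀ t ∈ Icc a b, |t - t₀| ≤ l := fun t ht =>
    abs_le.2 ⟨by linarith [ht.1], by linarith [ht.2]⟩
  have hξχ : ∀ t ∈ Icc a b, ξ t = χ t := fun t ht => by
    ext y
    simp only [hξ]
    rw [hτeq t ((htime t ht).trans hlr)]
  have hstay : ∀ t ∈ Icc a b, ∀ y ∈ Icc y₀ y₁, |ξ t y - x₀| < r := fun t ht y hyy =>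
    hSS (mk_mem_prod (hkS (Metric.mem_closedBall.2 ((htime t ht).trans (min_le_left _ _))))
      (hS' hyy))
  have hbox : ∀ t ∈ Icc a b, ∀ x ∈ Icc (ξ t y₀) (ξ t y₁), |x - x₀| ≤ r := by
    intro t ht x hx
    have h1 := abs_lt.1 (hstay t ht y₀ (left_mem_Icc.2 hy))
    have h2 := abs_lt.1 (hstay t ht y₁ (right_mem_Icc.2 hy))
    exact abs_le.2 ⟨by linarith [hx.1], by linarith [hx.2]⟩
  have hmemQ : ∀ t ∈ Icc a b, ∀ x ∈ Icc (ξ t y₀) (ξ t y₁), (t, x) ∈ Ω ∧ u (t, x) ∈ Icc m₁ m₂ :=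
    fun t ht x hx => hQmem t x ((htime t ht).trans hlr) (hbox t ht x hx)
  have hξmem : ∀ t, ∀ y ∈ Icc y₀ y₁, ξ t y ∈ Icc (ξ t y₀) (ξ t y₁) := fun t y hyy =>
    ⟨hξmono t hyy.1, hξmono t hyy.2⟩
  set σ : ℝ → ℝ := fun x => max (x₀ - r) (min x (x₀ + r)) with hσ
  have hσeq : ∀ x, |x - x₀| ≤ r → σ x = x := by
    intro x hx
    have := abs_le.1 hx
    rw [hσ]
    simp only
    rw [min_eq_left (by linarith), max_eq_right (by linarith)]
  have hclamp : ∀ c x : ℝ, |max (c - r) (min x (c + r)) - c| ≤ r := fun c x =>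
    abs_le.2 ⟨by linarith [le_max_left (c - r) (min x (c + r))],
      by linarith [max_le (by linarith : c - r ≤ c + r) (min_le_right x (c + r))]⟩
  set v : ℝ × ℝ → ℝ := fun p => u (τ p.1, σ p.2) with hv
  have hvc : Continuous v :=
    hu.continuousOn.comp_continuous (f := fun p : ℝ × ℝ => (τ p.1, σ p.2)) (by fun_prop)
      fun p => (hQmem _ _ (hclamp _ _) (hclamp _ _)).1
  have hvu : ∀ t ∈ Icc a b, ∀ x ∈ Icc (ξ t y₀) (ξ t y₁), v (t, x) = u (t, x) := by
    intro t ht x hx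
    simp only [hv]
    rw [hτeq t ((htime t ht).trans hlr), hσeq x (hbox t ht x hx)]
  have hder : ∀ t ∈ Ioo a b, ∀ y ∈ Icc y₀ y₁,
      HasDerivAt (fun s => ξ s y) (deriv f (v (t, ξ t y))) t := by
    intro t ht y hyy
    have ht' := Ioo_subset_Icc_self ht
    rw [hvu t ht' _ (hξmem t y hyy), hξχ t ht']
    refine (hu.param.characteristic y t ?_).congr_of_eventuallyEq ?_
    · have := (hmemQ t ht' _ (hξmem t y hyy)).1
      rwa [hξχ t ht'] at this
    · filter_upwards [Ioo_mem_nhds ht.1 ht.2] with s hs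
      rw [hξχ s (Ioo_subset_Icc_self hs)]
  have hlip : ∀ y ∈ Icc y₀ y₁, ∀ s ∈ Icc a b, ∀ t ∈ Icc a b,
      |v (t, ξ t y) - v (s, ξ s y)| ≤ G * |t - s| := by
    intro y hyy s hs t ht
    rw [hvu t ht _ (hξmem t y hyy), hvu s hs _ (hξmem s y hyy), hξχ t ht, hξχ s hs]
    refine (hu.deriv_eq y).abs_sub_le (isOpen_curveTimes hΩ hΩ_sub hu.param y)
      (continuousOn_curve hΩ_sub hu.continuousOn hu.param y) (hG y) (a := a) (b := b)
      (fun t ht => ?_) s hs t ht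
    have := (hmemQ t ht _ (hξmem t y hyy)).1
    rwa [hξχ t ht] at this
  set V : Set (ℝ × ℝ) := {p | p.1 ∈ Ioo a b ∧ p.2 ∈ Ioo (ξ p.1 y₀) (ξ p.1 y₁)} with hV
  have hVQ : ∀ p ∈ V, p ∈ Ω ∧ u p ∈ Icc m₁ m₂ := fun p hp =>
    hmemQ p.1 (Ioo_subset_Icc_self hp.1) p.2 (Ioo_subset_Icc_self hp.2)
  refine ⟨V, ?_, ?_, fun p hp => (hVQ p hp).1, fun p hp => (hVQ p hp).2, ?_⟩
  · have h0 := (hξy y₀).comp (continuous_fst (X := ℝ) (Y := ℝ))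
    have h1 := (hξy y₁).comp (continuous_fst (X := ℝ) (Y := ℝ))
    exact ((isOpen_lt continuous_const continuous_fst).inter
      (isOpen_lt continuous_fst continuous_const)).inter
      ((isOpen_lt h0 continuous_snd).inter (isOpen_lt continuous_snd h1))
  · refine ⟨⟨by simp [ha, hl0], by simp [hb, hl0]⟩, ?_⟩
    simp only [hξ₀, hy₀, hy₁]
    exact ⟨by linarith, by linarith⟩
  intro η q c hpair hc φ hφ
  have hηc : Continuous η := hpair.entropy_smooth.continuous
  have hqc : Continuous q := hpair.flux_smooth.continuous
  have hφ1 : ContDiff ℝ 1 φ := hφ.smooth.of_le (by exact_mod_cast le_top)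
  have hfd : Continuous (fderiv ℝ φ) := hφ1.continuous_fderiv one_ne_zero
  set θ : ℝ × ℝ → ℝ := fun p =>
    fderiv ℝ φ p (1, 0) * η (v p) + fderiv ℝ φ p (0, 1) * q (v p) with hθ
  have hθc : Continuous θ := by fun_prop
  have hθ0 : ∀ p ∉ V, θ p = 0 := fun p hp => by simp [hθ, hφ.fderiv_eq_zero hp]
  have hθs : HasCompactSupport θ := by
    refine HasCompactSupport.intro hφ.compact fun p hp => ?_
    have : fderiv ℝ φ p = 0 :=
      image_eq_zero_of_notMem_tsupport fun h => hp (tsupport_fderiv_subset ℝ h)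
    simp [hθ, this]
  have hpairing : fluxPairing Ω (fun x => η (u x)) (fun x => q (u x)) φ =
      ∫ t in a..b, ∫ x in ξ t y₀..ξ t y₁, θ (t, x) := by
    rw [← integral_eq_integral_strip (hθc.integrable_of_hasCompactSupport hθs) hab
      (fun t => hξmono t hy) hθ0, fluxPairing,
      setIntegral_eq_integral_of_forall_compl_eq_zero fun p hp => ?_]
    · refine integral_congr_ae (ae_of_all _ fun p => ?_)
      by_cases hp : p ∈ V
      · simp only [hθ]
        rw [show v p = u p from
          hvu p.1 (Ioo_subset_Icc_self hp.1) p.2 (Ioo_subset_Icc_self hp.2)]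
      · simp [hθ, hφ.fderiv_eq_zero hp]
    · simp [hφ.fderiv_eq_zero fun h => hp (hVQ p h).1]
  have habs : ∫ x, |φ x| = ∫ t in a..b, ∫ x in ξ t y₀..ξ t y₁, |φ (t, x)| :=
    integral_eq_integral_strip
      (hφ.smooth.continuous.integrable_of_hasCompactSupport hφ.compact).abs hab
      (fun t => hξmono t hy) fun p hp => by rw [hφ.eq_zero hp, abs_zero]
  rw [hpairing, habs]
  refine hpair.abs_integral_strip_le hf hvc hξc hξmono hab hy hder hlip (fun t ht x hx => ?_) hc hφ1
    hφ.compact (fun x => hφ.eq_zero fun h => ?_) (fun x => hφ.eq_zero fun h => ?_)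
    (fun t _ => hφ.eq_zero fun h => ?_) (fun t _ => hφ.eq_zero fun h => ?_)
  · rw [hvu t ht x hx]
    exact (hmemQ t ht x hx).2
  · exact lt_irrefl _ h.1.1
  · exact lt_irrefl _ h.1.2
  · exact lt_irrefl _ h.2.1
  · exact lt_irrefl _ h.2.2

/-! ### The Eulerian source and the entropy balance. -/

lemma IsTestFunction.integrable_fderiv_mul {Ω : Set (ℝ × ℝ)} {φ : ℝ × ℝ → ℝ}
    (hφ : IsTestFunction Ω φ) {w : ℝ × ℝ → ℝ} (hw : ContinuousOn w Ω) (e : ℝ × ℝ) :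
    Integrable fun p => fderiv ℝ φ p e * w p := by
  have hfd : Continuous (fderiv ℝ φ) := hφ.smooth.continuous_fderiv (by simp)
  rw [← integrableOn_iff_integrable_of_support_subset (s := tsupport φ)]
  · exact ((hfd.clm_apply continuous_const).continuousOn.mul
      (hw.mono hφ.supp)).integrableOn_compact hφ.compact
  · refine Function.support_subset_iff'.2 fun p hp => ?_
    rw [image_eq_zero_of_notMem_tsupport fun h => hp (tsupport_fderiv_subset ℝ h)]
    simp

lemma IsTestFunction.integrable_mul {E : Type*} [NormedAddCommGroup E] [NormedSpace ℝ E]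
    [MeasurableSpace E] [BorelSpace E] {μ : Measure E} [IsFiniteMeasureOnCompacts μ]
    {Ω : Set E} {φ : E → ℝ} (hφ : IsTestFunction Ω φ) {w : E → ℝ} (hw : ContinuousOn w Ω) :
    Integrable (fun p => φ p * w p) μ := by
  rw [← integrableOn_iff_integrable_of_support_subset (s := tsupport φ)]
  · exact (hφ.smooth.continuous.continuousOn.mul (hw.mono hφ.supp)).integrableOn_compact hφ.compact
  · refine Function.support_subset_iff'.2 fun p hp => ?_
    rw [image_eq_zero_of_notMem_tsupport hp, zero_mul]

section fluxPairing

variable {Ω : Set (ℝ × ℝ)} {a b a' b' φ ψ : ℝ × ℝ → ℝ}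

lemma integrableOn_fluxPairing (ha : ContinuousOn a Ω) (hb : ContinuousOn b Ω)
    (hφ : IsTestFunction Ω φ) :
    IntegrableOn (fun p => fderiv ℝ φ p (1, 0) * a p + fderiv ℝ φ p (0, 1) * b p) Ω :=
  ((hφ.integrable_fderiv_mul ha _).add (hφ.integrable_fderiv_mul hb _)).integrableOn

lemma fluxPairing_add (ha : ContinuousOn a Ω) (hb : ContinuousOn b Ω) (hφ : IsTestFunction Ω φ)
    (hψ : IsTestFunction Ω ψ) :
    fluxPairing Ω a b (φ + ψ) = fluxPairing Ω a b φ + fluxPairing Ω a b ψ := by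
  unfold fluxPairing
  rw [← integral_add (integrableOn_fluxPairing ha hb hφ) (integrableOn_fluxPairing ha hb hψ)]
  refine integral_congr_ae (ae_of_all _ fun p => ?_)
  have h1 := hφ.smooth.differentiable (by simp) p
  have h2 := hψ.smooth.differentiable (by simp) p
  simp only [fderiv_add h1 h2, add_apply]
  ring

lemma fluxPairing_smul (r : ℝ) : fluxPairing Ω a b (r • φ) = r * fluxPairing Ω a b φ := by
  unfold fluxPairing
  rw [← integral_const_mul]
  refine integral_congr_ae (ae_of_all _ fun p => ?_)
  simp only [fderiv_const_smul_field, Pi.smul_apply, smul_apply, smul_eq_mul]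
  ring

lemma fluxPairing_sub_const_mul (ha : ContinuousOn a Ω) (hb : ContinuousOn b Ω)
    (ha' : ContinuousOn a' Ω) (hb' : ContinuousOn b' Ω) (hφ : IsTestFunction Ω φ) (r : ℝ) :
    fluxPairing Ω (fun p => a p - r * a' p) (fun p => b p - r * b' p) φ =
      fluxPairing Ω a b φ - r * fluxPairing Ω a' b' φ := by
  unfold fluxPairing
  rw [← integral_const_mul, ← integral_sub (integrableOn_fluxPairing ha hb hφ)
    ((integrableOn_fluxPairing ha' hb' hφ).const_mul r)]
  refine integral_congr_ae (ae_of_all _ fun p => ?_)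
  ring

end fluxPairing

lemma isEntropyPair_id {f : ℝ → ℝ} (hf : ContDiff ℝ 1 f) : IsEntropyPair f (fun z => z) f :=
  ⟨contDiff_id, hf, fun z => by simp⟩

lemma IsEntropyPair.deriv_sub_const_mul_id {f η q : ℝ → ℝ} (h : IsEntropyPair f η q) (r z : ℝ) :
    deriv (fun z => η z - r * z) z = deriv η z - r := by
  have hη := h.entropy_smooth.differentiable one_ne_zero
  simpa only [mul_one] using ((hη z).hasDerivAt.fun_sub ((hasDerivAt_id' z).const_mul r)).deriv

lemma IsEntropyPair.sub_const_mul_id {f η q : ℝ → ℝ} (h : IsEntropyPair f η q)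
    (hf : ContDiff ℝ 1 f) (r : ℝ) :
    IsEntropyPair f (fun z => η z - r * z) (fun z => q z - r * f z) := by
  have hq := h.flux_smooth.differentiable one_ne_zero
  have hfd := hf.differentiable one_ne_zero
  refine ⟨h.entropy_smooth.sub (contDiff_const.mul contDiff_id),
    h.flux_smooth.sub (contDiff_const.mul hf), fun z => ?_⟩
  have h2 : deriv (fun z => q z - r * f z) z = deriv q z - r * deriv f z :=
    ((hq z).hasDerivAt.sub ((hfd z).hasDerivAt.const_mul r)).deriv
  rw [h.deriv_sub_const_mul_id, h2, h.deriv_flux]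
  ring

/-- A continuous Lagrangian solution satisfies the balance law in the sense of distributions, with a
source bounded by `G`. -/
lemma IsLagrangianSolution.exists_source {f : ℝ → ℝ} (hf : ContDiff ℝ 1 f)
    {Ω : Set (ℝ × ℝ)} (hΩ : IsOpen Ω) (hΩ_sub : Ω ⊆ halfPlane) {u : ℝ × ℝ → ℝ} {χ : ℝ → ℝ → ℝ}
    {g : ℝ × ℝ → ℝ} (hu : IsLagrangianSolution f Ω u χ g) {G : ℝ} (hG0 : 0 ≤ G)
    (hG : LagrangianSourceBound Ω χ g G) :
    ∃ gE : ℝ × ℝ → ℝ, LocallyIntegrable gE ∧ (∀ᵐ p ∂(volume.restrict Ω), |gE p| ≤ G) ∧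
      DistribBalance Ω u (fun p => f (u p)) gE := by
  have hfu : ContinuousOn (fun p => f (u p)) Ω := hf.continuous.comp_continuousOn hu.continuousOn
  have hglobal : ∀ φ, IsTestFunction Ω φ →
      |fluxPairing Ω u (fun p => f (u p)) φ| ≤ G * ∫ p, |φ p| := by
    intro φ hφ
    refine abs_le_of_locally_abs_le volume (fun φ ψ => fluxPairing_add hu.continuousOn hfu)
      (by simp [fluxPairing]) (fun p hp => ?_) hφ
    obtain ⟨V, hVo, hpV, hVΩ, -, hV⟩ := hu.exists_nhds_abs_fluxPairing_le
      (hf.continuous_deriv le_rfl) hΩ hΩ_sub hG hp (m₁ := u p - 1) (m₂ := u p + 1)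
      ⟨by linarith, by linarith⟩
    refine ⟨V, hVo, hpV, hVΩ, fun φ hφ => ?_⟩
    -- The identity entropy has flux f and derivative 1, so c = 1 and the source gets the bound G
    -- itself.
    simpa using hV _ _ 1 (isEntropyPair_id hf) (fun s _ => by simp) φ hφ
  let L : testFunctions Ω →ₗ[ℝ] ℝ :=
    { toFun := fun φ => -fluxPairing Ω u (fun p => f (u p)) φ.1
      map_add' := fun φ ψ => by
        rw [Submodule.coe_add, fluxPairing_add hu.continuousOn hfu φ.2 ψ.2, neg_add]
      map_smul' := fun r φ => by
        rw [Submodule.coe_smul, fluxPairing_smul, RingHom.id_apply, smul_eq_mul, mul_neg] }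
  obtain ⟨gE, hloc, hbd, hrep⟩ := exists_eq_integral_of_abs_le (μ := volume) hΩ L hG0
    (fun φ => (abs_neg _).trans_le (hglobal φ.1 φ.2))
  refine ⟨gE, hloc, hbd, fun φ hφ => ?_⟩
  refine (hrep ⟨φ, hφ⟩).trans
    (setIntegral_eq_integral_of_forall_compl_eq_zero fun p hp => ?_).symm
  change φ p * gE p = 0
  rw [hφ.eq_zero hp, zero_mul]

/-- A continuous Lagrangian solution dissipates no entropy. -/
lemma IsLagrangianSolution.entropy_balance {f : ℝ → ℝ} (hf : ContDiff ℝ 1 f)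
    {Ω : Set (ℝ × ℝ)} (hΩ : IsOpen Ω) (hΩ_sub : Ω ⊆ halfPlane) {u : ℝ × ℝ → ℝ} {χ : ℝ → ℝ → ℝ}
    {g : ℝ × ℝ → ℝ} (hu : IsLagrangianSolution f Ω u χ g) {G : ℝ} (hG0 : 0 ≤ G)
    (hG : LagrangianSourceBound Ω χ g G) {gE : ℝ × ℝ → ℝ} (hloc : LocallyIntegrable gE)
    (hbd : ∀ᵐ p ∂(volume.restrict Ω), |gE p| ≤ G)
    (hbal : DistribBalance Ω u (fun p => f (u p)) gE) {η q : ℝ → ℝ} (h : IsEntropyPair f η q) :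
    DistribBalance Ω (fun p => η (u p)) (fun p => q (u p)) (fun p => deriv η (u p) * gE p) := by
  have hdη : Continuous (deriv η) := h.entropy_smooth.continuous_deriv le_rfl
  have hfu : ContinuousOn (fun p => f (u p)) Ω := hf.continuous.comp_continuousOn hu.continuousOn
  have hηu : ContinuousOn (fun p => η (u p)) Ω :=
    h.entropy_smooth.continuous.comp_continuousOn hu.continuousOn
  have hqu : ContinuousOn (fun p => q (u p)) Ω :=
    h.flux_smooth.continuous.comp_continuousOn hu.continuousOn
  have hdηu : ContinuousOn (fun p => deriv η (u p)) Ω := hdη.comp_continuousOn hu.continuousOn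
  have hint : ∀ {w : ℝ × ℝ → ℝ}, ContinuousOn w Ω → ∀ {φ}, IsTestFunction Ω φ →
      IntegrableOn (fun p => φ p * (w p * gE p)) Ω := by
    intro w hw φ hφ
    refine ((hφ.integrable_mul (μ := volume) hw).integrableOn.mul_bdd
      hloc.aestronglyMeasurable.restrict hbd).congr (ae_of_all _ fun p => ?_)
    exact mul_assoc _ _ _
  -- D is the defect in the entropy balance, to be shown zero.
  set D : (ℝ × ℝ → ℝ) → ℝ := fun φ => fluxPairing Ω (fun p => η (u p)) (fun p => q (u p)) φ +
    ∫ p in Ω, φ p * (deriv η (u p) * gE p) with hD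
  have hadd : ∀ φ ψ, IsTestFunction Ω φ → IsTestFunction Ω ψ → D (φ + ψ) = D φ + D ψ := by
    intro φ ψ hφ hψ
    simp only [hD, fluxPairing_add hηu hqu hφ hψ, Pi.add_apply, add_mul]
    rw [integral_add (hint hdηu hφ) (hint hdηu hψ)]
    ring
  have hsmall : ∀ ε > 0, ∀ φ, IsTestFunction Ω φ → |D φ| ≤ 2 * ε * G * ∫ p, |φ p| := by
    intro ε hε φ hφ
    refine abs_le_of_locally_abs_le volume hadd (by simp [hD, fluxPairing]) (fun p hp => ?_) hφ
    -- Freeze η' at u p. The entropy η − r·id has derivative at most ε near u p, which bounds the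
    -- flux part by εG; the source term with η'(u) − r is bounded by another εG, whence the factor
    -- 2. The balance law for u cancels the contributions of r.
    set r := deriv η (u p) with hr
    obtain ⟨δ, hδ, hηδ⟩ := Metric.continuous_iff.1 hdη (u p) ε hε
    have hc : ∀ s ∈ Icc (u p - δ / 2) (u p + δ / 2), |deriv η s - r| ≤ ε := by
      intro s hs
      refine (Real.dist_eq _ _ ▸ hηδ s ?_).le
      rw [Real.dist_eq]
      exact abs_lt.2 ⟨by linarith [hs.1], by linarith [hs.2]⟩
    obtain ⟨V, hVo, hpV, hVΩ, hVu, hV⟩ := hu.exists_nhds_abs_fluxPairing_le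
      (hf.continuous_deriv le_rfl) hΩ hΩ_sub hG hp (m₁ := u p - δ / 2) (m₂ := u p + δ / 2)
      ⟨by linarith, by linarith⟩
    refine ⟨V, hVo, hpV, hVΩ, fun φ hφV => ?_⟩
    have hφ := hφV.mono hVΩ
    have h1 := hV _ _ ε (h.sub_const_mul_id hf r)
      (fun s hs => by rw [h.deriv_sub_const_mul_id]; exact hc s hs) φ hφV
    rw [fluxPairing_sub_const_mul hηu hqu hu.continuousOn hfu hφ] at h1
    have h2 : |∫ p in Ω, φ p * ((deriv η (u p) - r) * gE p)| ≤ ε * G * ∫ p, |φ p| := by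
      have hφi : Integrable φ :=
        hφ.smooth.continuous.integrable_of_hasCompactSupport hφ.compact
      calc _ ≤ ∫ p in Ω, |φ p * ((deriv η (u p) - r) * gE p)| := abs_integral_le_integral_abs
        _ ≤ ∫ p in Ω, ε * G * |φ p| := by
          refine integral_mono_of_nonneg (ae_of_all _ fun _ => abs_nonneg _)
            (hφi.abs.const_mul _).integrableOn ?_
          filter_upwards [hbd] with x hx
          by_cases hxV : x ∈ V
          · rw [abs_mul, abs_mul, mul_comm |φ x|]
            have := hc _ (hVu x hxV)
            gcongr
          · rw [hφV.eq_zero hxV]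
            simp
        _ = ε * G * ∫ p, |φ p| := by
          rw [integral_const_mul, setIntegral_eq_integral_of_forall_compl_eq_zero fun p hp => by
            rw [hφ.eq_zero hp, abs_zero]]
    have hsplit : ∫ p in Ω, φ p * ((deriv η (u p) - r) * gE p) =
        (∫ p in Ω, φ p * (deriv η (u p) * gE p)) - r * ∫ p in Ω, φ p * gE p := by
      rw [← integral_const_mul, ← integral_sub (hint hdηu hφ)]
      · refine integral_congr_ae (ae_of_all _ fun p => ?_)
        ring
      · refine IntegrableOn.congr_fun (hint (w := fun _ => r) continuousOn_const hφ)
          (fun p _ => ?_) hΩ.measurableSet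
        ring
    rw [hsplit, ← hbal φ hφ] at h2
    have hDφ : D φ = (fluxPairing Ω (fun p => η (u p)) (fun p => q (u p)) φ -
        r * fluxPairing Ω u (fun p => f (u p)) φ) +
        ((∫ p in Ω, φ p * (deriv η (u p) * gE p)) -
          r * -fluxPairing Ω u (fun p => f (u p)) φ) := by
      simp only [hD]
      ring
    rw [hDφ]
    refine (abs_add_le _ _).trans ((add_le_add h1 h2).trans_eq ?_)
    ring
  intro φ hφ
  have hI : 0 ≤ ∫ p, |φ p| := integral_nonneg fun p => abs_nonneg _
  have hzero : |D φ| ≤ 0 := by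
    refine le_of_forall_pos_le_add fun e he => ?_
    rw [zero_add]
    set W := 2 * G * ∫ p, |φ p| with hW
    have hW0 : 0 ≤ W := by positivity
    refine (hsmall (e / (W + 1)) (by positivity) φ hφ).trans ?_
    rw [show 2 * (e / (W + 1)) * G * ∫ p, |φ p| = e * W / (W + 1) by rw [hW]; ring,
      div_le_iff₀ (by positivity)]
    nlinarith
  have := abs_nonpos_iff.1 hzero
  change -fluxPairing Ω (fun p => η (u p)) (fun p => q (u p)) φ = _
  simp only [hD] at this
  linarith

theorem corollaryC (f : ℝ → ℝ) (hf : ContDiff ℝ 2 f)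
    (Ω : Set (ℝ × ℝ)) (hΩ : IsOpen Ω) (hΩ_sub : Ω ⊆ halfPlane)
    (u : ℝ × ℝ → ℝ) (χ : ℝ → ℝ → ℝ) (gL : ℝ × ℝ → ℝ)
    (hu : IsLagrangianSolution f Ω u χ gL)
    (G : ℝ) (hG : LagrangianSourceBound Ω χ gL G) :
    ∃ gE : ℝ × ℝ → ℝ,
      IsEulerianSolution f Ω u gE ∧
      (∀ᵐ p ∂(volume.restrict Ω), |gE p| ≤ G) ∧
      ∀ η q : ℝ → ℝ, IsEntropyPair f η q →
        DistribBalance Ω (fun p => η (u p)) (fun p => q (u p))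
          (fun p => deriv η (u p) * gE p) := by
  have hf1 : ContDiff ℝ 1 f := hf.of_le (by norm_num)
  -- For empty Ω the bound is void and G may be negative. Otherwise a curve through a point of Ω
  -- spends positive time in it, which forces G ≥ 0.
  rcases Ω.eq_empty_or_nonempty with rfl | ⟨⟨t, x⟩, hp⟩
  · exact ⟨0, ⟨hu.continuousOn, by simp, fun φ _ => by simp⟩, by simp, fun η q _ φ _ => by simp⟩
  have hG0 : 0 ≤ G := by
    obtain ⟨y, hy⟩ := hu.param.surjective t (hΩ_sub hp).1 x
    refine nonneg_of_ae_abs_le (isOpen_curveTimes hΩ hΩ_sub hu.param y) ⟨t, ?_⟩ (hG y)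
    change (t, χ t y) ∈ Ω
    rwa [hy]
  obtain ⟨gE, hloc, hbd, hbal⟩ := hu.exists_source hf1 hΩ hΩ_sub hG0 hG
  refine ⟨gE, ⟨hu.continuousOn, ?_, hbal⟩, hbd, fun η q h =>
    hu.entropy_balance hf1 hΩ hΩ_sub hG0 hG hloc hbd hbal h⟩
  exact memLp_top_of_bound hloc.aestronglyMeasurable.restrict G hbd
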